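/- Let $\mathcal T$ be a locally finite leafless tree, and give $\mathrm{Aut}(\mathcal T)$ the permutation topology. An action of a group on a locally finite leafless tree is *almost boundary-transitive* with fixed end $\xi$ if its image in the automorphism group of the tree is closed, it fixes $\xi$, and it is transitive on the other ends; it is *focal* if moreover some element acts as a translation and $\xi$ is the only end fixed by the group. A *scale group action* is a continuous, proper, vertex-transitive and almost boundary-transitive action of a totally disconnected locally compact group on a locally finite tree with more than two ends. Let $G\le\mathrm{Aut}(\mathcal T)$ be a closed subgroup whose action on $\mathcal T$ is focal and almost boundary-transitive, with fixed end $\xi$ and minimum translation length $l$. Let $\xi'\neq\xi$ be an end of $\mathcal T$, let $\mathcal L$ be the line between $\xi$ and $\xi'$, let $H=G_{\xi'}$, and let $U_0$ be the pointwise fixator of $\mathcal L$ in $G$. Write $\mathrm{Sub}(G/H)$ for the set of closed subgroups $K$ with $H\le K\le G$. For a subgroup $U \le G$ and $K\in\mathrm{Sub}(G/H)$, say that $K$ is *$U$-thin over* $H$ if $(K\cap U)H$ is a closed subgroup of $G$. Then there is an element $s\in H$ which is a translation towards $\xi$ of length $l$ and satisfies $H=U_0\rtimes\langle s\rangle$,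 and the following hold. 1. For each $K\in\mathrm{Sub}(G/H)$ there is a smallest $K$-invariant (non-empty) subtree $\mathcal T_K$ of $\mathcal T$. 2. For $K,K'\in\mathrm{Sub}(G/H)$ we have $\mathcal T_K\subseteq\mathcal T_{K'}$ if and only if $K\le K'$. Moreover $\mathcal L\subseteq\mathcal T_K$ for all $K\in\mathrm{Sub}(G/H)$, with equality if and only if $K=H$. 3. Let $K\in\mathrm{Sub}(G/H)\setminus\{H\}$. Then the action of $K$ on $\mathcal T_K$ is focal and almost boundary-transitive, with fixed end $\xi$ and minimum translation length $l$. Moreover $K$ is compactly generated, and if the action of $G$ on $\mathcal T$ is a scale group action, then so is the action of $K$ on $\mathcal T_K$. 4. Let $K\in\mathrm{Sub}(G/H)\setminus\{H\}$. Then $K$ is not $U$-thin over $H$ for any compact open subgroup $U$ of $G$ containing $U_0$. In addition, for every translation $s\in H$ towards $\xi$ of length $l$ and every vertex $v$ of $\mathcal L$, the stabilizer $K_v$ does not fix $s^{-1}v$. 5. Every element of $\mathrm{Sub}(G/H)\setminus\{H\}$ contains a minimal element of $\mathrm{Sub}(G/H)\setminus\{H\}$. -/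

import Mathlib

open scoped Pointwise

namespace TreeFocal

section Ends

variable {V : Type*} {W : Type*}

/-- A ray in a graph: a one-sided infinite path without repeated vertices. -/
structure Ray (T : SimpleGraph V) where
  toFun : ℕ → V
  adj : ∀ n, T.Adj (toFun n) (toFun (n + 1))
  inj : Function.Injective toFun

/-- Two rays of a tree are equivalent if they have a common tail. -/
instance raySetoid (T : SimpleGraph V) : Setoid (Ray T) where
  r r₁ r₂ := ∃ m n : ℕ, ∀ k, r₁.toFun (m + k) = r₂.toFun (n + k)
  iseqv :=
    { refl := fun _ => ⟨0, 0, fun _ => rfl⟩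
      symm := fun ⟨m, n, h⟩ => ⟨n, m, fun k => (h k).symm⟩
      trans := by
        rintro a b c ⟨m, n, h⟩ ⟨p, q, h'⟩
        refine ⟨m + p, q + n, fun k => ?_⟩
        have h1 := h (p + k)
        have h2 := h' (n + k)
        rw [show m + p + k = m + (p + k) by ring, h1,
          show n + (p + k) = p + (n + k) by ring, h2,
          show q + n + k = q + (n + k) by ring] }

/-- The set of ends (the boundary) of a tree: rays up to equality of tails. -/
def TreeEnd (T : SimpleGraph V) : Type _ := Quotient (raySetoid T)

/-- The end represented by a ray. -/
def Ray.toEnd {T : SimpleGraph V} (r : Ray T) : TreeEnd T := Quotient.mk (raySetoid T) r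

/-- The image of a ray under a graph embedding. -/
def Ray.map {T : SimpleGraph V} {T' : SimpleGraph W} (f : T ↪g T') (r : Ray T) : Ray T' where
  toFun n := f (r.toFun n)
  adj n := f.map_rel_iff.2 (r.adj n)
  inj := f.injective.comp r.inj

/-- The map on ends induced by a graph embedding. -/
def TreeEnd.map {T : SimpleGraph V} {T' : SimpleGraph W} (f : T ↪g T') :
    TreeEnd T → TreeEnd T' :=
  Quotient.map (Ray.map f) fun _ _ ⟨m, n, h⟩ => ⟨m, n, fun k => congrArg f (h k)⟩

/-- The action of the automorphism group of a tree on the ends. -/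
instance endAction (T : SimpleGraph V) : MulAction (T ≃g T) (TreeEnd T) where
  smul g e := TreeEnd.map g.toEmbedding e
  one_smul e := by
    induction e using Quotient.inductionOn
    rfl
  mul_smul g h e := by
    induction e using Quotient.inductionOn
    rfl

/-- A bi-infinite line (with a parametrization by `ℤ`). -/
structure Line (T : SimpleGraph V) where
  toFun : ℤ → V
  adj : ∀ i, T.Adj (toFun i) (toFun (i + 1))
  inj : Function.Injective toFun

/-- The positive half of a line. -/
def Line.posRay {T : SimpleGraph V} (ℓ : Line T) : Ray T where
  toFun n := ℓ.toFun n
  adj n := by simpa using ℓ.adj n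
  inj := fun a b h => by simpa using ℓ.inj h

/-- The negative half of a line. -/
def Line.negRay {T : SimpleGraph V} (ℓ : Line T) : Ray T where
  toFun n := ℓ.toFun (-n)
  adj n := by
    have h := ℓ.adj (-(n : ℤ) - 1)
    rw [sub_add_cancel] at h
    have e : (-((n + 1 : ℕ) : ℤ)) = -(n : ℤ) - 1 := by push_cast; ring
    rw [e]
    exact h.symm
  inj := fun a b h => by simpa using ℓ.inj h

/-- The vertex set of the line between two (distinct) ends `ξ'` and `ξ` of a tree. -/
def lineBetween {T : SimpleGraph V} (ξ ξ' : TreeEnd T) : Set V :=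
  {v | ∃ ℓ : Line T, ℓ.posRay.toEnd = ξ ∧ ℓ.negRay.toEnd = ξ' ∧ v ∈ Set.range ℓ.toFun}

/-- `g` is a translation (hyperbolic automorphism) of length `n > 0` towards the end `ξ`:
it translates some line, its axis, by `n` steps in the direction of `ξ`. -/
def IsTranslationToward {T : SimpleGraph V} (g : T ≃g T) (n : ℕ) (ξ : TreeEnd T) : Prop :=
  0 < n ∧ ∃ ℓ : Line T, ℓ.posRay.toEnd = ξ ∧ ∀ i : ℤ, g (ℓ.toFun i) = ℓ.toFun (i + n)

/-- `g` is a translation of length `n > 0`. -/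
def IsTranslation {T : SimpleGraph V} (g : T ≃g T) (n : ℕ) : Prop :=
  ∃ ξ : TreeEnd T, IsTranslationToward g n ξ

/-- A tree is leafless if no vertex has exactly one neighbour. -/
def Leafless (T : SimpleGraph V) : Prop := ∀ v, (T.neighborSet v).encard ≠ 1

/-- Every vertex has only finitely many neighbours. -/
def IsLocallyFinite (T : SimpleGraph V) : Prop := ∀ v, (T.neighborSet v).Finite

/-- The permutation topology on the automorphism group of a graph, that is, the topology of
pointwise convergence on the discrete set of vertices. -/
instance autTopology (T : SimpleGraph V) : TopologicalSpace (T ≃g T) :=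
  TopologicalSpace.induced (fun (g : T ≃g T) (v : V) => g v)
    (@Pi.topologicalSpace V (fun _ => V) (fun _ => ⊥))

end Ends

section Actions

variable {V : Type*} {Γ : Type*} [Group Γ]

/-- An action `ρ` of a group on a locally finite leafless tree `T` is almost boundary-transitive
with fixed end `ξ` if its image is closed in `Aut(T)`, it fixes `ξ`, and it is transitive on the
remaining ends.  A closed subgroup `G` of `Aut(T)` is covered by taking for `ρ` the inclusion. -/
structure IsAlmostBoundaryTransitive {T : SimpleGraph V} (ρ : Γ →* (T ≃g T)) (ξ : TreeEnd T) :
    Prop where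
  isTree : T.IsTree
  locallyFinite : IsLocallyFinite T
  leafless : Leafless T
  closed_range : IsClosed (Set.range ρ)
  fixes : ∀ g, ρ g • ξ = ξ
  transitive : ∀ e e' : TreeEnd T, e ≠ ξ → e' ≠ ξ → ∃ g, ρ g • e = e'

/-- A focal almost boundary-transitive action: it contains a translation, and `ξ` is the only end
that it fixes.  (The first condition excludes the cases of an action without translation,
the second excludes the lineal case, where the tree is just a line.) -/
structure IsFocal {T : SimpleGraph V} (ρ : Γ →* (T ≃g T)) (ξ : TreeEnd T) : Prop
    extends IsAlmostBoundaryTransitive ρ ξ where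
  exists_translation : ∃ g n, IsTranslation (ρ g) n
  unique_fixed : ∀ e : TreeEnd T, (∀ g, ρ g • e = e) → e = ξ

/-- `l` is the minimum of the lengths of the translations in the action. -/
def IsMinTranslationLength {T : SimpleGraph V} (ρ : Γ →* (T ≃g T)) (l : ℕ) : Prop :=
  IsLeast {n | ∃ g, IsTranslation (ρ g) n} l

/-- A scale group action: a continuous, proper, vertex-transitive, almost boundary-transitive
action of a totally disconnected locally compact group on a locally finite tree with more than
two ends.  As the vertex set is discrete, continuity means that the sets `{g | g v = w}` are open
and properness that they are compact. -/
structure IsScaleGroupAction [TopologicalSpace Γ] {T : SimpleGraph V} (ρ : Γ →* (T ≃g T)) :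
    Prop where
  topologicalGroup : IsTopologicalGroup Γ
  t2 : T2Space Γ
  locallyCompact : LocallyCompactSpace Γ
  totallyDisconnected : TotallyDisconnectedSpace Γ
  continuous : ∀ v w : V, IsOpen {g : Γ | ρ g v = w}
  proper : ∀ v w : V, IsCompact {g : Γ | ρ g v = w}
  vertexTransitive : ∀ v w : V, ∃ g, ρ g v = w
  almostBoundaryTransitive : ∃ ξ, IsAlmostBoundaryTransitive ρ ξ
  moreThanTwoEnds : ∃ a b c : TreeEnd T, a ≠ b ∧ a ≠ c ∧ b ≠ c

end Actions

section Subgroups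

variable {V : Type*}

/-- A set `S` of vertices of a tree is (the vertex set of) a subtree if the graph induced on it is
connected; in particular `S` is not empty. -/
def IsSubtree (T : SimpleGraph V) (S : Set V) : Prop := (T.induce S).Connected

/-- `S` is invariant under the group `K` of automorphisms. -/
def IsInvariant {T : SimpleGraph V} (K : Subgroup (T ≃g T)) (S : Set V) : Prop :=
  ∀ g ∈ K, ∀ v ∈ S, g v ∈ S

/-- The intersection of all `K`-invariant subtrees. It is the minimal tree of `K` if it is itself
an invariant subtree. -/
def minimalTree {T : SimpleGraph V} (K : Subgroup (T ≃g T)) : Set V :=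
  ⋂₀ {S | IsSubtree T S ∧ IsInvariant K S}

theorem isInvariant_minimalTree {T : SimpleGraph V} (K : Subgroup (T ≃g T)) :
    IsInvariant K (minimalTree K) :=
  fun g hg v hv S hS => hS.2 g hg v (hv S hS)

/-- The action of `K` on a `K`-invariant subtree. -/
def restrictAction {T : SimpleGraph V} (K : Subgroup (T ≃g T)) (S : Set V)
    (hS : IsInvariant K S) : K →* (T.induce S ≃g T.induce S) where
  toFun g :=
    { toFun := fun v => ⟨(g : T ≃g T) v, hS g g.2 v v.2⟩
      invFun := fun v => ⟨(g : T ≃g T)⁻¹ v, hS _ (K.inv_mem g.2) v v.2⟩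
      left_inv := fun v => Subtype.ext ((g : T ≃g T).symm_apply_apply v)
      right_inv := fun v => Subtype.ext ((g : T ≃g T).apply_symm_apply v)
      map_rel_iff' := fun {a b} => (g : T ≃g T).map_rel_iff' (a := (a : V)) (b := (b : V)) }
  map_one' := rfl
  map_mul' _ _ := rfl

/-- The action of `K` on its minimal tree. -/
def minimalTreeAction {T : SimpleGraph V} (K : Subgroup (T ≃g T)) :
    K →* (T.induce (minimalTree K) ≃g T.induce (minimalTree K)) :=
  restrictAction K (minimalTree K) (isInvariant_minimalTree K)

/-- The stabilizer in `G` of an end. -/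
def endStabilizer {T : SimpleGraph V} (G : Subgroup (T ≃g T)) (ξ : TreeEnd T) :
    Subgroup (T ≃g T) :=
  G ⊓ MulAction.stabilizer (T ≃g T) ξ

/-- The pointwise fixator in `G` of a set of vertices. -/
def fixator {T : SimpleGraph V} (G : Subgroup (T ≃g T)) (S : Set V) : Subgroup (T ≃g T) :=
  G ⊓ fixingSubgroup (T ≃g T) S

end Subgroups

section TopGroups

variable {A : Type*} [Group A] [TopologicalSpace A]

/-- The closed subgroups `K` with `H ≤ K ≤ G` (where `G` is itself closed in the ambient group `A`,
so that "closed in `G`" and "closed in `A`" are the same). -/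
def closedOvergroups (G H : Subgroup A) : Set (Subgroup A) :=
  {K | IsClosed (K : Set A) ∧ H ≤ K ∧ K ≤ G}

/-- `K` is `U`-thin over `H` if the product set `(K ∩ U)H` is a closed subgroup. -/
def IsThin (U K H : Subgroup A) : Prop :=
  ∃ L : Subgroup A, (L : Set A) = ((K ⊓ U : Subgroup A) : Set A) * (H : Set A) ∧
    IsClosed (L : Set A)

/-- `K` is generated, as an abstract group, by a compact subset. -/
def IsCompactlyGenerated (K : Subgroup A) : Prop :=
  ∃ C : Set A, IsCompact C ∧ Subgroup.closure C = K

/-- `H` is the internal semidirect product of its normal subgroup `N` by the infinite cyclic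
subgroup generated by `s`. -/
def IsSemidirectCyclic (H N : Subgroup A) (s : A) : Prop :=
  (N.subgroupOf H).Normal ∧ N ⊔ Subgroup.zpowers s = H ∧ N ⊓ Subgroup.zpowers s = ⊥ ∧
    Function.Injective (fun n : ℤ => s ^ n)

end TopGroups

end TreeFocal

/-! The fixed end ξ turns the tree into a genealogy: every vertex has a parent, the next vertex
towards ξ, and an integer level. An automorphism fixing ξ commutes with the parent map and changes
all levels by one constant, its `shift`. On G this is a homomorphism to ℤ; a translation has length
|shift|, and minimality of l makes every shift a multiple of l. Ends other than ξ correspond to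
lines descending from ξ parametrized by level, the horolines. A conjugate of a shortest translation
lies in H, and U₀ is the kernel of the shift on H, whence the semidirect product.

For H ≤ K ≤ G the minimal tree is the union of the K-translates of the line: it is closed under
parents, and powers of s drag a vertex of any invariant subtree both below and above each vertex of
the line (`lineOrbit_subset`). Since vertex stabilizers are compact, every horoline inside this
union is itself a K-translate of the line (`exists_apply_eq`). That gives transitivity on ends and,
because H ≤ K, recovers K from its tree.

If K ≠ H, then K moves ξ'. As K is generated by s and the stabilizer of one vertex v of the line, K
would fix ξ' if that stabilizer fixed s⁻¹v (`smul_bottom_of_fixes`). This local criterion refutes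
thinness. It also exhibits K ≠ H by a nonempty compact set of elements, so properness survives
intersections of chains and Zorn's lemma yields minimal overgroups. -/

namespace TreeFocal

/-! ### Parents and levels defined by an end (Busemann function). -/

section ParentMaps

variable {V : Type*} {T : SimpleGraph V}

/-- The combinatorial structure that a tree inherits from one of its ends `ξ`: every vertex `v`
has a parent `up v`, the next vertex on the way to `ξ`, and a level which increases by one on
passing to the parent. -/
structure ParentMap (T : SimpleGraph V) (ξ : TreeEnd T) where
  up : V → V
  lev : V → ℤ
  ray : Ray T
  adj_iff : ∀ u v, T.Adj u v ↔ up u = v ∨ up v = u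
  lev_up : ∀ v, lev (up v) = lev v + 1
  join : ∀ u v, ∃ m n, up^[m] u = up^[n] v
  up_ray : ∀ n, up (ray.toFun n) = ray.toFun (n + 1)
  toEnd_ray : ray.toEnd = ξ

/-- Prefixing geodesics to `x` by the two edges gives two paths from `v` to `x`, which coincide in a
tree. -/
theorem closer_neighbor_unique (hT : T.IsTree) {v w w' x : V} (h : T.Adj v w) (h' : T.Adj v w')
    (hd : T.dist v x = T.dist w x + 1) (hd' : T.dist v x = T.dist w' x + 1) : w = w' := by
  obtain ⟨q, hq⟩ := hT.connected.exists_walk_length_eq_dist w x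
  obtain ⟨q', hq'⟩ := hT.connected.exists_walk_length_eq_dist w' x
  have e := (hT.existsUnique_path v x).unique
    ((SimpleGraph.Walk.cons h q).isPath_of_length_eq_dist (by simp [hq, hd]))
    ((SimpleGraph.Walk.cons h' q').isPath_of_length_eq_dist (by simp [hq', hd']))
  have := congrArg SimpleGraph.Walk.snd e
  simpa using this

theorem exists_closer_neighbor (hT : T.IsTree) {v x : V} (h : v ≠ x) :
    ∃ w, T.Adj v w ∧ T.dist v x = T.dist w x + 1 := by
  obtain ⟨q, hq⟩ := hT.connected.exists_walk_length_eq_dist v x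
  cases q with
  | nil => exact absurd rfl h
  | cons hvw q =>
    rename_i w
    refine ⟨w, hvw, ?_⟩
    have h1 := T.dist_le q
    have h2 := hT.dist_eq_dist_add_one_of_adj x hvw
    simp only [SimpleGraph.Walk.length_cons] at hq
    rw [SimpleGraph.dist_comm (u := x) (v := v), SimpleGraph.dist_comm (u := x) (v := w)] at h2
    omega

/-- Rays in a tree are geodesic: at the first decrease in distance, a vertex would have both its
predecessor and its successor as closer neighbours. -/
theorem Ray.dist_zero (hT : T.IsTree) (r : Ray T) (n : ℕ) :
    T.dist (r.toFun 0) (r.toFun n) = n := by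
  suffices h : T.dist (r.toFun 0) (r.toFun n) = n ∧
      T.dist (r.toFun 0) (r.toFun (n + 1)) = n + 1 from h.1
  induction n with
  | zero => exact ⟨by simp, SimpleGraph.dist_eq_one_iff_adj.2 (r.adj 0)⟩
  | succ n ih =>
    refine ⟨ih.2, ?_⟩
    have h := hT.dist_eq_dist_add_one_of_adj (r.toFun 0) (r.adj (n + 1))
    rcases h with h | h
    · exfalso
      have := closer_neighbor_unique hT (x := r.toFun 0) (r.adj (n + 1)) (r.adj n).symm
        (by rw [T.dist_comm, h, T.dist_comm])
        (by rw [T.dist_comm, ih.2, T.dist_comm, ih.1])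
      have := r.inj this
      omega
    · omega

/-- The integers n − d(v, r n) increase with n and are bounded by d(v, r 0), hence stabilize. The
limit is the Busemann function, used below as the level. -/
theorem Ray.exists_busemann (hT : T.IsTree) (r : Ray T) (v : V) :
    ∃ b : ℤ, (∀ n : ℕ, (n : ℤ) - T.dist v (r.toFun n) ≤ b) ∧
      ∃ N : ℕ, ∀ n ≥ N, (n : ℤ) - T.dist v (r.toFun n) = b := by
  have hmono : Monotone fun n : ℕ => (n : ℤ) - T.dist v (r.toFun n) := by
    refine monotone_nat_of_le_succ fun n => ?_
    have := hT.dist_eq_dist_add_one_of_adj v (r.adj n)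
    push_cast
    omega
  obtain ⟨b, ⟨N, hN⟩, hb⟩ := Int.exists_greatest_of_bdd
    (P := fun z => ∃ n : ℕ, (n : ℤ) - T.dist v (r.toFun n) = z)
    ⟨T.dist v (r.toFun 0), by
      rintro z ⟨n, rfl⟩
      have h1 := hT.connected.dist_triangle (u := r.toFun 0) (v := v) (w := r.toFun n)
      rw [r.dist_zero hT, SimpleGraph.dist_comm (u := r.toFun 0)] at h1
      omega⟩ ⟨_, 0, rfl⟩
  exact ⟨b, fun n => hb _ ⟨n, rfl⟩, N, fun n hn =>
    le_antisymm (hb _ ⟨n, rfl⟩) (hN.symm.le.trans (hmono hn))⟩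

/-- The parent is the unique neighbour with Busemann value larger by one. Iterated parents of any
vertex reach the ray, which gives common ancestors. -/
theorem exists_parentMap (hT : T.IsTree) (ξ : TreeEnd T) : Nonempty (ParentMap T ξ) := by
  obtain ⟨r, rfl⟩ := Quotient.exists_rep ξ
  choose b hb N hN using r.exists_busemann hT
  have hadj : ∀ {v w}, T.Adj v w → b w = b v + 1 ∨ b v = b w + 1 := by
    intro v w h
    have h1 := hN v (N v + N w) (by omega)
    have h2 := hN w (N v + N w) (by omega)
    have h3 := hT.dist_eq_dist_add_one_of_adj (r.toFun (N v + N w)) h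
    rw [SimpleGraph.dist_comm (v := v), SimpleGraph.dist_comm (v := w)] at h3
    omega
  have huniq : ∀ {v w w'}, T.Adj v w → T.Adj v w' → b w = b v + 1 → b w' = b v + 1 → w = w' := by
    intro v w w' h h' e e'
    have h1 := hN v (N v + N w + N w') (by omega)
    have h2 := hN w (N v + N w + N w') (by omega)
    have h3 := hN w' (N v + N w + N w') (by omega)
    exact closer_neighbor_unique hT (x := r.toFun (N v + N w + N w')) h h' (by omega) (by omega)
  have hcloser : ∀ {v} {n : ℕ}, (n : ℤ) - T.dist v (r.toFun n) = b v → v ≠ r.toFun n →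
      ∃ w, T.Adj v w ∧ b w = b v + 1 ∧ T.dist v (r.toFun n) = T.dist w (r.toFun n) + 1 := by
    intro v n hn hne
    obtain ⟨w, hw, hd⟩ := exists_closer_neighbor hT hne
    refine ⟨w, hw, ?_, hd⟩
    have h1 := hb w n
    have h2 := hadj hw
    omega
  have hex : ∀ v, ∃ w, T.Adj v w ∧ b w = b v + 1 := by
    intro v
    -- Taking n > b v excludes `v = r.toFun n`, where the distance 0 would force n = b v.
    obtain ⟨n, hn, hn'⟩ : ∃ n, N v ≤ n ∧ b v < n := ⟨N v + (b v).toNat + 1, by omega, by omega⟩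
    have h1 := hN v n hn
    obtain ⟨w, hw, h, -⟩ := hcloser h1 (by
      intro e
      rw [← e, SimpleGraph.dist_self] at h1
      simp at h1
      omega)
    exact ⟨w, hw, h⟩
  choose up hup hlev using hex
  have hreach : ∀ d v (n : ℕ), (n : ℤ) - T.dist v (r.toFun n) = b v → T.dist v (r.toFun n) = d →
      up^[d] v = r.toFun n := by
    intro d
    induction d with
    | zero =>
      intro v n _ h
      exact (hT.connected.dist_eq_zero_iff).1 h
    | succ d ih =>
      intro v n h1 h2
      obtain ⟨w, hw, hbw, hd⟩ := hcloser h1 (by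
        intro e
        rw [← e, SimpleGraph.dist_self] at h2
        omega)
      have e : up v = w := huniq (hup v) hw (hlev v) hbw
      rw [Function.iterate_succ_apply, e]
      exact ih w n (by omega) (by omega)
  have hbr : ∀ n, b (r.toFun n) = n := by
    intro n
    have h1 := hb (r.toFun n) n
    simp only [SimpleGraph.dist_self] at h1
    have h2 := hN (r.toFun n) (N (r.toFun n) + n) (by omega)
    have h3 := hT.connected.dist_triangle (u := r.toFun 0) (v := r.toFun n)
      (w := r.toFun (N (r.toFun n) + n))
    rw [r.dist_zero hT, r.dist_zero hT] at h3
    push_cast at h2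
    omega
  refine ⟨⟨up, b, r, fun u v => ⟨fun h => ?_, ?_⟩, hlev, fun u v => ?_, fun n => ?_, rfl⟩⟩
  · rcases hadj h with h' | h'
    · exact Or.inl (huniq (hup u) h (hlev u) h')
    · exact Or.inr (huniq (hup v) h.symm (hlev v) h')
  · rintro (rfl | rfl)
    · exact hup u
    · exact (hup v).symm
  · exact ⟨_, _, (hreach _ u (N u + N v) (hN u (N u + N v) (by omega)) rfl).trans
      (hreach _ v (N u + N v) (hN v (N u + N v) (by omega)) rfl).symm⟩
  · exact huniq (hup _) (r.adj n) (hlev _) (by rw [hbr, hbr]; push_cast; ring)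

end ParentMaps

end TreeFocal

namespace TreeFocal

variable {V : Type*} {T : SimpleGraph V} {ξ : TreeEnd T}

namespace ParentMap

/-! ### Ascending and descending rays. -/

section Rays

variable (P : ParentMap T ξ)

theorem lev_iterate (n : ℕ) (v : V) : P.lev (P.up^[n] v) = P.lev v + n := by
  induction n with
  | zero => simp
  | succ n ih => rw [Function.iterate_succ_apply', P.lev_up, ih]; push_cast; ring

theorem up_up_ne (v : V) : P.up (P.up v) ≠ v := by
  intro h
  have := congrArg P.lev h
  rw [P.lev_up, P.lev_up] at this
  omega

/-- A ray that follows the parent map leads to the distinguished end, and conversely. -/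
theorem toEnd_eq_iff (r : Ray T) : r.toEnd = ξ ↔ ∀ n, P.up (r.toFun n) = r.toFun (n + 1) := by
  constructor
  · intro h
    rw [← P.toEnd_ray] at h
    obtain ⟨m, n, hmn⟩ := Quotient.exact h
    intro j
    refine ((P.adj_iff _ _).1 (r.adj j)).resolve_right fun hj => ?_
    -- After one step down, a step up would return to the previous vertex, so the ray descends
    -- forever and cannot share a tail with an ascending ray.
    have hdown : ∀ k, P.up (r.toFun (j + k + 1)) = r.toFun (j + k) := by
      intro k
      induction k with
      | zero => exact hj
      | succ k ih =>
        refine ((P.adj_iff _ _).1 (r.adj (j + k + 1))).resolve_left fun hk => ?_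
        have := r.inj (ih.symm.trans hk)
        omega
    have h1 := hdown m
    rw [show j + m + 1 = m + (j + 1) by ring, show j + m = m + j by ring, hmn, hmn,
      ← add_assoc, ← P.up_ray] at h1
    exact P.up_up_ne _ h1
  · intro h
    rw [← P.toEnd_ray]
    obtain ⟨m, n, hmn⟩ := P.join (r.toFun 0) (P.ray.toFun 0)
    have h1 : ∀ k, r.toFun k = P.up^[k] (r.toFun 0) := by
      intro k
      induction k with
      | zero => rfl
      | succ k ih => rw [Function.iterate_succ_apply', ← ih, h]
    have h2 : ∀ k, P.ray.toFun k = P.up^[k] (P.ray.toFun 0) := by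
      intro k
      induction k with
      | zero => rfl
      | succ k ih => rw [Function.iterate_succ_apply', ← ih, P.up_ray]
    refine Quotient.sound ⟨m, n, fun k => ?_⟩
    rw [h1, h2, add_comm m, add_comm n, Function.iterate_add_apply, hmn,
      Function.iterate_add_apply]

theorem exists_descending {r : Ray T} (hr : r.toEnd ≠ ξ) :
    ∃ N, ∀ k, P.up (r.toFun (N + k + 1)) = r.toFun (N + k) := by
  rw [Ne, P.toEnd_eq_iff, not_forall] at hr
  obtain ⟨j, hj⟩ := hr
  refine ⟨j, fun k => ?_⟩
  induction k with
  | zero => exact ((P.adj_iff _ _).1 (r.adj j)).resolve_left hj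
  | succ k ih =>
    refine ((P.adj_iff _ _).1 (r.adj (j + k + 1))).resolve_left fun hk => ?_
    have := r.inj (ih.symm.trans hk)
    omega

/-- The ray from a vertex to the distinguished end. -/
def upRay (v : V) : Ray T where
  toFun n := P.up^[n] v
  adj n := (P.adj_iff _ _).2 (Or.inl (Function.iterate_succ_apply' _ _ _).symm)
  inj a b h := by
    have := congrArg P.lev h
    simpa [P.lev_iterate] using this

theorem toEnd_upRay (v : V) : (P.upRay v).toEnd = ξ :=
  (P.toEnd_eq_iff _).2 fun _ => (Function.iterate_succ_apply' _ _ _).symm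

end Rays

/-! ### Automorphisms fixing the end, and their level shifts. -/

section Shift

variable (P : ParentMap T ξ) {g h : T ≃g T}

/-- The image of the ascending ray from `v` still leads to ξ, so its first step is again to the
parent. -/
theorem apply_up (hg : g • ξ = ξ) (v : V) : g (P.up v) = P.up (g v) := by
  have h1 : ((P.upRay v).map g.toEmbedding).toEnd = ξ := by
    conv_rhs => rw [← hg, ← P.toEnd_upRay v]
    rfl
  exact ((P.toEnd_eq_iff _).1 h1 0).symm

theorem apply_iterate_up (hg : g • ξ = ξ) (n : ℕ) (v : V) :
    g (P.up^[n] v) = P.up^[n] (g v) := by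
  induction n with
  | zero => rfl
  | succ n ih =>
    rw [Function.iterate_succ_apply', P.apply_up hg, ih, Function.iterate_succ_apply']

/-- The amount by which an automorphism fixing the distinguished end shifts the levels. -/
def shift (g : T ≃g T) : ℤ := P.lev (g (P.ray.toFun 0)) - P.lev (P.ray.toFun 0)

/-- The change of level is constant because any vertex has a common ancestor with the base vertex.
-/
theorem lev_apply (hg : g • ξ = ξ) (v : V) : P.lev (g v) = P.lev v + P.shift g := by
  obtain ⟨m, n, hmn⟩ := P.join v (P.ray.toFun 0)
  have h1 := congrArg P.lev hmn
  have h2 := congrArg (fun x => P.lev (g x)) hmn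
  simp only [P.apply_iterate_up hg, P.lev_iterate] at h1 h2
  unfold shift
  omega

theorem shift_eq_zero_of_fixes (hg : g • ξ = ξ) {v : V} (hv : g v = v) : P.shift g = 0 := by
  have := P.lev_apply hg v
  rw [hv] at this
  omega

theorem shift_one : P.shift 1 = 0 := P.shift_eq_zero_of_fixes (one_smul _ ξ) (v := P.ray.toFun 0) rfl

theorem shift_mul (hg : g • ξ = ξ) (hh : h • ξ = ξ) : P.shift (g * h) = P.shift g + P.shift h := by
  have h1 := P.lev_apply (g := g * h) (by rw [mul_smul, hh, hg]) (P.ray.toFun 0)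
  rw [RelIso.mul_apply, P.lev_apply hg, P.lev_apply hh] at h1
  omega

theorem shift_inv (hg : g • ξ = ξ) : P.shift g⁻¹ = -P.shift g := by
  have := P.shift_mul (g := g⁻¹) (h := g) (inv_smul_eq_iff.2 hg.symm) hg
  rw [inv_mul_cancel, P.shift_one] at this
  omega

theorem smul_zpow_eq (hg : g • ξ = ξ) (n : ℤ) : g ^ n • ξ = ξ :=
  (MulAction.stabilizer (T ≃g T) ξ).zpow_mem hg n

theorem shift_zpow (hg : g • ξ = ξ) (n : ℤ) : P.shift (g ^ n) = n * P.shift g := by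
  induction n using Int.induction_on with
  | zero => simp [P.shift_one]
  | succ n ih => rw [zpow_add_one, P.shift_mul (smul_zpow_eq hg _) hg, ih]; ring
  | pred n ih =>
    rw [zpow_sub_one, P.shift_mul (smul_zpow_eq hg _) (inv_smul_eq_iff.2 hg.symm), ih,
      P.shift_inv hg]
    ring

end Shift

/-- A line leading to the distinguished end, parametrized by the level. -/
structure IsHoroline (P : ParentMap T ξ) (m : ℤ → V) : Prop where
  up : ∀ i, P.up (m i) = m (i + 1)
  lev : ∀ i, P.lev (m i) = i

/-! ### Horolines and the ends other than ξ. -/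

section Horolines

variable {P : ParentMap T ξ} {m m' : ℤ → V} {g : T ≃g T}

theorem IsHoroline.injective (hm : P.IsHoroline m) : Function.Injective m := fun i j h => by
  rw [← hm.lev i, h, hm.lev]

theorem IsHoroline.iterate_up (hm : P.IsHoroline m) (n : ℕ) (i : ℤ) :
    P.up^[n] (m i) = m (i + n) := by
  induction n with
  | zero => simp
  | succ n ih => rw [Function.iterate_succ_apply', ih, hm.up]; push_cast; ring_nf

/-- The line underlying a horoline. -/
def IsHoroline.toLine (hm : P.IsHoroline m) : Line T where
  toFun := m
  adj i := (P.adj_iff _ _).2 (Or.inl (hm.up i))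
  inj := hm.injective

/-- The end at the bottom of a horoline. -/
def IsHoroline.bottom (hm : P.IsHoroline m) : TreeEnd T := hm.toLine.negRay.toEnd

theorem IsHoroline.toEnd_posRay (hm : P.IsHoroline m) : hm.toLine.posRay.toEnd = ξ :=
  (P.toEnd_eq_iff _).2 fun n => hm.up n

theorem IsHoroline.bottom_ne (hm : P.IsHoroline m) : hm.bottom ≠ ξ := fun h => by
  have h1 := congrArg P.lev ((P.toEnd_eq_iff _).1 h 0)
  rw [P.lev_up] at h1
  simp only [Line.negRay, IsHoroline.toLine, hm.lev] at h1
  norm_num at h1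

theorem IsHoroline.eq_of_eq_below (hm : P.IsHoroline m) (hm' : P.IsHoroline m') {i : ℤ}
    (h : ∀ j ≤ i, m j = m' j) : m = m' := by
  funext j
  obtain hj | hj := le_total j i
  · exact h j hj
  · obtain ⟨n, rfl⟩ := Int.le.dest hj
    rw [← hm.iterate_up, ← hm'.iterate_up, h i le_rfl]

theorem IsHoroline.eq_above (hm : P.IsHoroline m) (hm' : P.IsHoroline m') {i j : ℤ}
    (h : m i = m' i) (hij : i ≤ j) : m j = m' j := by
  obtain ⟨n, rfl⟩ := Int.le.dest hij
  rw [← hm.iterate_up, ← hm'.iterate_up, h]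

/-- Common tails must match level by level, so they agree without reparametrization; parents
determine the rest. -/
theorem IsHoroline.eq_of_bottom_eq (hm : P.IsHoroline m) (hm' : P.IsHoroline m')
    (h : hm.bottom = hm'.bottom) : m = m' := by
  obtain ⟨a, b, hab⟩ := Quotient.exact h
  simp only [Line.negRay, IsHoroline.toLine] at hab
  have h0 := congrArg P.lev (hab 0)
  simp only [hm.lev, hm'.lev] at h0
  obtain rfl : a = b := by omega
  refine hm.eq_of_eq_below hm' (i := -a) fun j hj => ?_
  have := hab (-a - j).toNat
  rwa [show (-((a + (-(a : ℤ) - j).toNat : ℕ) : ℤ)) = j by omega] at this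

theorem exists_horoline (P : ParentMap T ξ) {e : TreeEnd T} (he : e ≠ ξ) :
    ∃ (m : ℤ → V) (hm : P.IsHoroline m), hm.bottom = e := by
  obtain ⟨r, rfl⟩ := Quotient.exists_rep e
  obtain ⟨N, hN⟩ := P.exists_descending he
  set d : ℕ → V := fun k => r.toFun (N + k) with hd
  have hdown : ∀ k, P.up (d (k + 1)) = d k := hN
  set c := P.lev (d 0) with hc
  have hlev : ∀ k, P.lev (d k) = c - k := by
    intro k
    induction k with
    | zero => simp [hc]
    | succ k ih =>
      have := P.lev_up (d (k + 1))
      rw [hdown, ih] at this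
      push_cast
      omega
  -- Below level c this follows the descending tail, above it the ancestors of `d 0`; truncation by
  -- `toNat` makes one of the two exponents vanish.
  have hm : P.IsHoroline fun i : ℤ => P.up^[(i - c).toNat] (d (c - i).toNat) := by
    constructor
    · intro i
      obtain hi | hi := lt_or_ge i c
      · rw [show (i - c).toNat = 0 by omega, show (i + 1 - c).toNat = 0 by omega,
          show (c - i).toNat = (c - (i + 1)).toNat + 1 by omega]
        exact hdown _
      · rw [show (c - (i + 1)).toNat = (c - i).toNat by omega,
          show (i + 1 - c).toNat = (i - c).toNat + 1 by omega, Function.iterate_succ_apply']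
    · intro i
      rw [P.lev_iterate, hlev]
      omega
  refine ⟨_, hm, Quotient.sound ⟨(-c).toNat, N + c.toNat, fun k => ?_⟩⟩
  simp only [Line.negRay, IsHoroline.toLine]
  rw [show (-(((-c).toNat + k : ℕ) : ℤ) - c).toNat = 0 by omega,
    show (c - -(((-c).toNat + k : ℕ) : ℤ)).toNat = c.toNat + k by omega]
  simp [hd, add_assoc]

/-- The image of a horoline under an automorphism fixing the distinguished end. -/
theorem IsHoroline.apply (hm : P.IsHoroline m) (hg : g • ξ = ξ) :
    P.IsHoroline fun i => g (m (i - P.shift g)) where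
  up i := by rw [← P.apply_up hg, hm.up]; ring_nf
  lev i := by rw [P.lev_apply hg, hm.lev]; ring

theorem IsHoroline.bottom_apply (hm : P.IsHoroline m) (hg : g • ξ = ξ) :
    (hm.apply hg).bottom = g • hm.bottom := by
  refine Quotient.sound ⟨(-P.shift g).toNat, (P.shift g).toNat, fun k => congrArg (fun i => g (m i)) ?_⟩
  omega

/-- Converts statements about ends into statements about vertices. -/
theorem IsHoroline.smul_bottom_eq_iff (hm : P.IsHoroline m) (hm' : P.IsHoroline m')
    (hg : g • ξ = ξ) :
    g • hm.bottom = hm'.bottom ↔ ∀ i, g (m i) = m' (i + P.shift g) := by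
  rw [← hm.bottom_apply hg]
  constructor
  · intro h i
    have := congrFun ((hm.apply hg).eq_of_bottom_eq hm' h) (i + P.shift g)
    simpa using this
  · intro h
    have : (fun i => g (m (i - P.shift g))) = m' := by
      funext i
      simpa using h (i - P.shift g)
    subst this
    rfl

theorem _root_.TreeFocal.Line.up_of_toEnd_posRay (P : ParentMap T ξ) (ℓ : Line T)
    (h : ℓ.posRay.toEnd = ξ) (i : ℤ) : P.up (ℓ.toFun i) = ℓ.toFun (i + 1) := by
  have h1 : ∀ n : ℕ, P.up (ℓ.toFun n) = ℓ.toFun (n + 1) := fun n => (P.toEnd_eq_iff _).1 h n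
  induction i using Int.induction_on with
  | zero => exact h1 0
  | succ n => exact_mod_cast h1 (n + 1)
  | pred n ih =>
    refine ((P.adj_iff _ _).1 (ℓ.adj _)).resolve_right fun hj => ?_
    rw [show (-(n : ℤ) - 1 + 1) = -n by ring, ih] at hj
    have := ℓ.inj hj
    omega

theorem _root_.TreeFocal.Line.lev_of_toEnd_posRay (P : ParentMap T ξ) (ℓ : Line T)
    (h : ℓ.posRay.toEnd = ξ) (i : ℤ) : P.lev (ℓ.toFun i) = P.lev (ℓ.toFun 0) + i := by
  have h1 : ∀ i, P.lev (ℓ.toFun (i + 1)) = P.lev (ℓ.toFun i) + 1 := fun i => by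
    rw [← ℓ.up_of_toEnd_posRay P h, P.lev_up]
  induction i using Int.induction_on with
  | zero => simp
  | succ n ih => rw [h1, ih]; ring
  | pred n ih =>
    have := h1 (-(n : ℤ) - 1)
    rw [sub_add_cancel] at this
    omega

theorem IsHoroline.lineBetween_eq (hm : P.IsHoroline m) :
    lineBetween ξ hm.bottom = Set.range m := by
  ext v
  constructor
  · rintro ⟨ℓ, h1, h2, i, rfl⟩
    set c := P.lev (ℓ.toFun 0)
    have hℓ : P.IsHoroline fun i => ℓ.toFun (i - c) :=
      ⟨fun i => by rw [ℓ.up_of_toEnd_posRay P h1]; ring_nf,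
        fun i => by rw [ℓ.lev_of_toEnd_posRay P h1]; ring⟩
    have hb : hℓ.bottom = hm.bottom := by
      rw [← h2]
      refine Quotient.sound ⟨(-c).toNat, c.toNat, fun k => congrArg ℓ.toFun ?_⟩
      omega
    rw [← hℓ.eq_of_bottom_eq hm hb]
    exact ⟨i + c, by simp⟩
  · rintro ⟨i, rfl⟩
    exact ⟨hm.toLine, hm.toEnd_posRay, rfl, i, rfl⟩

end Horolines

/-! ### Translation lengths and axes. -/

section Translations

variable (P : ParentMap T ξ) {g : T ≃g T} {n : ℕ}

theorem shift_eq_of_isTranslationToward (hg : g • ξ = ξ) (h : IsTranslationToward g n ξ) :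
    P.shift g = n := by
  obtain ⟨-, ℓ, h1, h2⟩ := h
  have h3 := P.lev_apply hg (ℓ.toFun 0)
  rw [h2, ℓ.lev_of_toEnd_posRay P h1] at h3
  omega

/-- Either the axis ascends everywhere and the shift is n, or it descends from some vertex on and
the shift is −n. -/
theorem natAbs_shift_of_isTranslation (hg : g • ξ = ξ) (h : IsTranslation g n) :
    (P.shift g).natAbs = n := by
  obtain ⟨e, hn, ℓ, -, hℓ⟩ := h
  by_cases hup : ∀ i, P.up (ℓ.toFun i) = ℓ.toFun (i + 1)
  · have h1 : ℓ.posRay.toEnd = ξ := (P.toEnd_eq_iff _).2 fun n => hup n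
    rw [P.shift_eq_of_isTranslationToward hg ⟨hn, ℓ, h1, hℓ⟩]
    rfl
  · push Not at hup
    obtain ⟨j, hj⟩ := hup
    have hdown : ∀ k : ℕ, P.lev (ℓ.toFun (j + k)) = P.lev (ℓ.toFun j) - k ∧
        P.up (ℓ.toFun (j + k + 1)) = ℓ.toFun (j + k) := by
      intro k
      induction k with
      | zero => exact ⟨by simp, by simpa using ((P.adj_iff _ _).1 (ℓ.adj j)).resolve_left hj⟩
      | succ k ih =>
        have h1 := P.lev_up (ℓ.toFun (j + k + 1))
        rw [ih.2, ih.1] at h1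
        push_cast
        rw [← add_assoc]
        refine ⟨by omega, ((P.adj_iff _ _).1 (ℓ.adj (j + k + 1))).resolve_left fun hk => ?_⟩
        have := ℓ.inj (ih.2.symm.trans hk)
        omega
    have h1 := P.lev_apply hg (ℓ.toFun j)
    rw [hℓ, (hdown n).1] at h1
    omega

/-- Some `w` satisfies g w = upⁿ w with n the shift; the ascending segments from gᵠw to gᵠ⁺¹w then
glue to an axis. -/
theorem exists_axis (hg : g • ξ = ξ) (hpos : 0 < P.shift g) :
    ∃ m, P.IsHoroline m ∧ ∀ i, g (m i) = m (i + P.shift g) := by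
  obtain ⟨n, hn'⟩ := Int.eq_ofNat_of_zero_le hpos.le
  obtain ⟨w, hw⟩ : ∃ w, g w = P.up^[n] w := by
    obtain ⟨a, c, hac⟩ := P.join (P.ray.toFun 0) (g (P.ray.toFun 0))
    have h1 := congrArg P.lev hac
    rw [P.lev_iterate, P.lev_iterate, P.lev_apply hg] at h1
    -- Comparing levels gives a = n + c.
    refine ⟨P.up^[c] (P.ray.toFun 0), ?_⟩
    rw [P.apply_iterate_up hg, ← hac, ← Function.iterate_add_apply]
    congr 2
    omega
  have hpow : ∀ q : ℤ, P.up^[n] ((g ^ q) w) = (g ^ (q + 1)) w := fun q => by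
    rw [← P.apply_iterate_up (smul_zpow_eq hg q), ← hw, ← RelIso.mul_apply, zpow_add_one]
  set c := P.lev w
  have hlev : ∀ q : ℤ, P.lev ((g ^ q) w) = c + q * n := fun q => by
    rw [P.lev_apply (smul_zpow_eq hg q), P.shift_zpow hg, hn']
  have hmod : ∀ q : ℤ, ∀ r : ℕ, r < n → (q * n + r) / n = q ∧ (q * n + r) % n = r := by
    intro q r hr
    constructor
    · rw [add_comm, Int.add_mul_ediv_right _ _ (by omega),
        Int.ediv_eq_zero_of_lt (by omega) (by omega), zero_add]
    · rw [add_comm, Int.add_mul_emod_self_right, Int.emod_eq_of_lt (by omega) (by omega)]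
  -- Writing i − c = qn + r with 0 ≤ r < n, the vertex at level i is r steps above gᵠw.
  set m : ℤ → V := fun i => P.up^[((i - c) % n).toNat] ((g ^ ((i - c) / n)) w) with hm
  have hm' : ∀ (q : ℤ) (r : ℕ), r < n → m (c + q * n + r) = P.up^[r] ((g ^ q) w) := by
    intro q r hr
    simp only [hm, add_assoc, add_sub_cancel_left, (hmod q r hr).1, (hmod q r hr).2,
      Int.toNat_natCast]
  have hrep : ∀ i : ℤ, ∃ (q : ℤ) (r : ℕ), r < n ∧ i = c + q * n + r := by
    intro i
    have h1 := Int.emod_nonneg (i - c) (b := n) (by omega)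
    have h2 := Int.emod_lt_of_pos (i - c) (b := n) (by omega)
    have h3 := Int.mul_ediv_add_emod (i - c) n
    refine ⟨(i - c) / n, ((i - c) % n).toNat, by omega, ?_⟩
    rw [mul_comm, Int.toNat_of_nonneg h1]
    omega
  refine ⟨m, ⟨fun i => ?_, fun i => ?_⟩, fun i => ?_⟩
  · obtain ⟨q, r, hr, rfl⟩ := hrep i
    rw [hm' q r hr, ← Function.iterate_succ_apply' P.up]
    obtain hr' | hr' := Nat.lt_or_ge (r + 1) n
    · rw [← hm' q _ hr']
      push_cast
      ring_nf
    · have e : r.succ = n := by omega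
      rw [e, hpow]
      have := hm' (q + 1) 0 (by omega)
      simp only [Nat.cast_zero, add_zero, Function.iterate_zero_apply] at this
      rw [← this]
      congr 1
      have e' : (r : ℤ) + 1 = n := by omega
      linear_combination -e'
  · obtain ⟨q, r, hr, rfl⟩ := hrep i
    rw [hm' q r hr, P.lev_iterate, hlev]
  · obtain ⟨q, r, hr, rfl⟩ := hrep i
    rw [hm' q r hr, P.apply_iterate_up hg, ← RelIso.mul_apply, ← zpow_one_add, hn',
      show c + q * n + r + (n : ℤ) = c + (1 + q) * n + r by ring, hm' _ _ hr]

theorem IsHoroline.isTranslationToward {P : ParentMap T ξ} {m : ℤ → V} (hm : P.IsHoroline m)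
    (hn : 0 < n) (h : ∀ i, g (m i) = m (i + n)) : IsTranslationToward g n ξ :=
  ⟨hn, hm.toLine, hm.toEnd_posRay, h⟩

end Translations

end ParentMap

end TreeFocal

namespace TreeFocal

/-! ### The permutation topology: compact vertex transporters, local compactness. -/

section Topology

open Filter Topology

variable {V : Type*} {T : SimpleGraph V}

theorem tendsto_aut_nhds_iff {α : Type*} {F : Filter α} {φ : α → T ≃g T} {g : T ≃g T} :
    Tendsto φ F (𝓝 g) ↔ ∀ v, ∀ᶠ a in F, φ a v = g v := by
  let _ : TopologicalSpace V := ⊥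
  have : DiscreteTopology V := ⟨rfl⟩
  have hi : IsInducing (fun (g : T ≃g T) (v : V) => g v) := ⟨rfl⟩
  rw [hi.tendsto_nhds_iff, tendsto_pi_nhds]
  simp only [nhds_discrete, tendsto_pure, Function.comp_apply]

theorem eventually_apply_eq (g : T ≃g T) (v : V) : ∀ᶠ h in 𝓝 g, h v = g v :=
  tendsto_aut_nhds_iff.1 (tendsto_id (x := 𝓝 g)) v

theorem isOpen_of_local {S : Set (T ≃g T)} {v : V} (h : ∀ g ∈ S, ∀ k, k v = g v → k ∈ S) :
    IsOpen S :=
  isOpen_iff_mem_nhds.2 fun g hg => (eventually_apply_eq g v).mono fun k hk => h g hg k hk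

theorem isOpen_apply_eq (v w : V) : IsOpen {g : T ≃g T | g v = w} :=
  isOpen_of_local (v := v) fun _ hg _ hk => hk.trans hg

theorem isClosed_apply_eq (v w : V) : IsClosed {g : T ≃g T | g v = w} :=
  ⟨isOpen_of_local (v := v) fun _ hg _ hk h => hg (hk.symm.trans h)⟩

instance : T2Space (T ≃g T) := by
  refine t2Space_iff_disjoint_nhds.2 fun g h hne => ?_
  obtain ⟨v, hv⟩ : ∃ v, g v ≠ h v := by
    by_contra! H
    exact hne (RelIso.ext H)
  exact Filter.disjoint_iff.2 ⟨_, eventually_apply_eq g v, _, eventually_apply_eq h v,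
    Set.disjoint_left.2 fun k hk hk' => hv (Eq.trans (Eq.symm hk) hk')⟩

instance : TotallyDisconnectedSpace (T ≃g T) := by
  let _ : TopologicalSpace V := ⊥
  have : DiscreteTopology V := ⟨rfl⟩
  have hi : IsEmbedding (fun (g : T ≃g T) (v : V) => g v) :=
    ⟨⟨rfl⟩, fun g h e => RelIso.ext (congrFun e)⟩
  exact ⟨hi.isTotallyDisconnected (isTotallyDisconnected_of_totallyDisconnectedSpace _)⟩

instance : IsTopologicalGroup (T ≃g T) where
  continuous_mul := by
    refine continuous_iff_continuousAt.2 fun ⟨g, h⟩ => tendsto_aut_nhds_iff.2 fun v => ?_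
    rw [nhds_prod_eq]
    filter_upwards [(eventually_apply_eq g (h v)).prod_mk (eventually_apply_eq h v)]
      with ⟨a, b⟩ ⟨ha, hb⟩
    simp only [RelIso.mul_apply] at *
    rw [hb, ha]
  continuous_inv := by
    refine continuous_iff_continuousAt.2 fun g => tendsto_aut_nhds_iff.2 fun v => ?_
    filter_upwards [eventually_apply_eq g (g⁻¹ v)] with a ha
    rw [← RelIso.mul_apply g, mul_inv_cancel] at ha
    exact (a.symm_apply_eq).2 ha.symm

/-- If an ultrafilter of automorphisms is eventually constant at one vertex of a connected locally
finite graph, then it is at every vertex. -/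
theorem exists_eventually_apply_eq (hT : T.Connected) (hfin : IsLocallyFinite T)
    (F : Ultrafilter (T ≃g T)) {v w : V} (h : ∀ᶠ g : T ≃g T in F, g v = w) (u : V) :
    ∃ x, ∀ᶠ g : T ≃g T in F, g u = x := by
  have hvu := (SimpleGraph.reachable_iff_reflTransGen v u).1 (hT v u)
  induction hvu with
  | refl => exact ⟨w, h⟩
  | @tail b c _ hbc ih =>
    obtain ⟨x, hx⟩ := ih
    -- The image of `c` is eventually among the finitely many neighbours of `x`, so the ultrafilter
    -- selects one of them.
    have h1 : (⋃ y ∈ T.neighborSet x, {g : T ≃g T | g c = y}) ∈ F := by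
      filter_upwards [hx] with g hg
      simp only [Set.mem_iUnion]
      refine ⟨g c, ?_, rfl⟩
      rw [← hg]
      exact g.map_rel_iff.2 hbc
    obtain ⟨y, -, hy⟩ := (Ultrafilter.finite_biUnion_mem_iff (hfin x)).1 h1
    exact ⟨y, hy⟩

/-- An ultrafilter has a pointwise limit map. The inverses also have one, and it inverts the first,
so the limit is an automorphism. -/
theorem isCompact_apply_eq (hT : T.Connected) (hfin : IsLocallyFinite T) (v w : V) :
    IsCompact {g : T ≃g T | g v = w} := by
  refine isCompact_iff_ultrafilter_le_nhds.2 fun F hF => ?_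
  have hv : ∀ᶠ g : T ≃g T in F, g v = w := le_principal_iff.1 hF
  have hw : ∀ᶠ g : T ≃g T in F.map Inv.inv, g w = v :=
    mem_map.2 (hv.mono fun g hg => (g.symm_apply_eq).2 hg.symm)
  choose f hf using exists_eventually_apply_eq hT hfin F hv
  choose f' hf' using exists_eventually_apply_eq hT hfin _ hw
  replace hf' : ∀ u, ∀ᶠ g : T ≃g T in F, g⁻¹ u = f' u := hf'
  let φ : T ≃g T :=
    { toFun := f
      invFun := f'
      left_inv := fun u => by
        obtain ⟨g, h1, h2⟩ := ((hf u).and (hf' (f u))).exists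
        rw [← h2, ← h1]
        exact g.symm_apply_apply u
      right_inv := fun u => by
        obtain ⟨g, h1, h2⟩ := ((hf' u).and (hf (f' u))).exists
        rw [← h2, ← h1]
        exact g.apply_symm_apply u
      map_rel_iff' := fun {a b} => by
        obtain ⟨g, h1, h2⟩ := ((hf a).and (hf b)).exists
        change T.Adj (f a) (f b) ↔ _
        rw [← h1, ← h2]
        exact g.map_rel_iff }
  have hφ : (F : Filter (T ≃g T)) ≤ 𝓝 φ := tendsto_id'.1 (tendsto_aut_nhds_iff.2 hf)
  exact ⟨φ, (isClosed_apply_eq v w).mem_of_tendsto hφ hv, hφ⟩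

theorem locallyCompactSpace_aut (hT : T.Connected) (hfin : IsLocallyFinite T) :
    LocallyCompactSpace (T ≃g T) := by
  obtain ⟨v⟩ := hT.nonempty
  have : WeaklyLocallyCompactSpace (T ≃g T) :=
    ⟨fun g => ⟨_, isCompact_apply_eq hT hfin v (g v), eventually_apply_eq g v⟩⟩
  infer_instance

end Topology

/-! ### Restriction to invariant subtrees. -/

section Restriction

variable {V W : Type*} {T : SimpleGraph V} {T' : SimpleGraph W}

theorem TreeEnd.map_injective (f : T ↪g T') : Function.Injective (TreeEnd.map f) := by
  intro a b
  induction a, b using Quotient.inductionOn₂ with | h r r' => ?_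
  intro h
  obtain ⟨m, n, hmn⟩ := Quotient.exact h
  exact Quotient.sound ⟨m, n, fun k => f.injective (hmn k)⟩

/-- The end of `T` defined by an end of a subtree. -/
abbrev inducedEnd (S : Set V) (e : TreeEnd (T.induce S)) : TreeEnd T :=
  TreeEnd.map (SimpleGraph.Embedding.induce S) e

theorem inducedEnd_injective (S : Set V) : Function.Injective (inducedEnd (T := T) S) :=
  TreeEnd.map_injective _

theorem inducedEnd_restrictAction_smul {K : Subgroup (T ≃g T)} {S : Set V}
    (hS : IsInvariant K S) (k : K) (e : TreeEnd (T.induce S)) :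
    inducedEnd S (restrictAction K S hS k • e) = (k : T ≃g T) • inducedEnd S e := by
  induction e using Quotient.inductionOn
  rfl

theorem isTranslation_of_restrictAction {K : Subgroup (T ≃g T)} {S : Set V}
    (hS : IsInvariant K S) {k : K} {n : ℕ} (h : IsTranslation (restrictAction K S hS k) n) :
    IsTranslation (k : T ≃g T) n := by
  obtain ⟨e, hn, ℓ, -, h⟩ := h
  let ℓ' : Line T := ⟨fun i => ℓ.toFun i, ℓ.adj, Subtype.val_injective.comp ℓ.inj⟩
  exact ⟨_, hn, ℓ', rfl, fun i => congrArg Subtype.val (h i)⟩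

/-- The restriction of a closed group of automorphisms of a locally finite graph to an invariant
connected subgraph is closed. -/
theorem isClosed_range_restrictAction (hT : T.Connected) (hfin : IsLocallyFinite T)
    {K : Subgroup (T ≃g T)} (hK : IsClosed (K : Set (T ≃g T))) {S : Set V} (hne : S.Nonempty)
    (hS : IsInvariant K S) : IsClosed (Set.range (restrictAction K S hS)) := by
  obtain ⟨v, hv⟩ := hne
  have hcont : Continuous (restrictAction K S hS) := by
    refine continuous_iff_continuousAt.2 fun k => tendsto_aut_nhds_iff.2 fun w => ?_
    filter_upwards [continuous_subtype_val.continuousAt.eventually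
      (eventually_apply_eq (k : T ≃g T) w)] with a ha
    exact Subtype.ext ha
  refine isClosed_of_closure_subset fun φ hφ => ?_
  have hcpt : IsCompact {k : K | (k : T ≃g T) v = φ ⟨v, hv⟩} :=
    hK.isClosedEmbedding_subtypeVal.isCompact_preimage (isCompact_apply_eq hT hfin _ _)
  -- Near φ only elements agreeing with φ at `v` matter; they form a compact set, whose image is
  -- closed.
  have h1 : φ ∈ closure (restrictAction K S hS '' {k : K | (k : T ≃g T) v = φ ⟨v, hv⟩}) := by
    refine mem_closure_iff_frequently.2 (((mem_closure_iff_frequently.1 hφ).and_eventually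
      (eventually_apply_eq φ ⟨v, hv⟩)).mono ?_)
    rintro _ ⟨⟨k, rfl⟩, hk⟩
    exact ⟨k, congrArg Subtype.val hk, rfl⟩
  rw [(hcpt.image hcont).isClosed.closure_eq] at h1
  exact Set.image_subset_range _ _ h1

end Restriction

end TreeFocal

namespace TreeFocal

variable {V : Type*} {T : SimpleGraph V} {ξ : TreeEnd T}

/-! ### The minimal tree as the orbit of a line. -/

namespace ParentMap

theorem isSubtree_of_up_mem (P : ParentMap T ξ) {S : Set V} (hne : S.Nonempty)
    (hS : ∀ v ∈ S, P.up v ∈ S) : IsSubtree T S := by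
  have hmem : ∀ n, ∀ v ∈ S, P.up^[n] v ∈ S := fun n v hv => by
    induction n with
    | zero => exact hv
    | succ n ih => rw [Function.iterate_succ_apply']; exact hS _ ih
  have hreach : ∀ n, ∀ v (hv : v ∈ S),
      (T.induce S).Reachable ⟨v, hv⟩ ⟨P.up^[n] v, hmem n v hv⟩ := fun n v hv => by
    induction n with
    | zero => exact SimpleGraph.Reachable.refl _
    | succ n ih =>
      refine ih.trans (SimpleGraph.Adj.reachable ?_)
      exact (P.adj_iff _ _).2 (Or.inl (Function.iterate_succ_apply' _ _ _).symm)
  have : Nonempty S := hne.to_subtype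
  refine ⟨?_⟩
  rintro ⟨u, hu⟩ ⟨v, hv⟩
  obtain ⟨a, c, hac⟩ := P.join u v
  have h1 := hreach a u hu
  simp only [hac] at h1
  exact h1.trans (hreach c v hv).symm

/-- A subtree that contains a descendant of `x` and a vertex that is not a descendant of `x`
contains `x`. -/
theorem mem_of_isSubtree (P : ParentMap T ξ) {S : Set V} (hS : IsSubtree T S) {u w x : V}
    (hu : u ∈ S) (hw : w ∈ S) (hux : ∃ a, P.up^[a] u = x) (hwx : ∀ a, P.up^[a] w ≠ x) :
    x ∈ S := by
  by_contra hx
  have hr := (SimpleGraph.reachable_iff_reflTransGen _ _).1 (hS.preconnected ⟨u, hu⟩ ⟨w, hw⟩)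
  suffices ∃ a, P.up^[a] w = x from hwx _ this.choose_spec
  suffices ∀ z : S, Relation.ReflTransGen (T.induce S).Adj ⟨u, hu⟩ z → ∃ a, P.up^[a] z = x from
    this _ hr
  intro z hz
  induction hz with
  | refl => exact hux
  | @tail b c _ hbc ih =>
    obtain ⟨a, ha⟩ := ih
    rcases (P.adj_iff _ _).1 hbc with h | h
    · cases a with
      | zero => exact absurd (ha ▸ b.2) hx
      | succ a =>
        refine ⟨a, ?_⟩
        rw [← ha, Function.iterate_succ_apply]
        exact congrArg _ h.symm
    · refine ⟨a + 1, ?_⟩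
      rw [Function.iterate_succ_apply, ← ha]
      exact congrArg _ h

theorem IsHoroline.fixes_above {P : ParentMap T ξ} {m : ℤ → V} (hm : P.IsHoroline m)
    {g : T ≃g T} (hg : g • ξ = ξ) {i j : ℤ} (hi : g (m i) = m i) (hij : i ≤ j) :
    g (m j) = m j := by
  have h0 := P.shift_eq_zero_of_fixes hg hi
  have h1 := (hm.apply hg).eq_above hm (i := i) (j := j)
  simp only [h0, sub_zero] at h1
  exact h1 hi hij

theorem IsHoroline.exists_fixes_above {P : ParentMap T ξ} {m : ℤ → V} (hm : P.IsHoroline m)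
    {g : T ≃g T} (hg : g • ξ = ξ) (h0 : P.shift g = 0) (i : ℤ) :
    ∃ a : ℕ, g (m (i + a)) = m (i + a) := by
  obtain ⟨a, c, hac⟩ := P.join (m i) (g (m i))
  have hl := congrArg P.lev hac
  rw [P.lev_iterate, P.lev_iterate, P.lev_apply hg, h0] at hl
  obtain rfl : a = c := by omega
  rw [← P.apply_iterate_up hg, hm.iterate_up] at hac
  exact ⟨a, hac.symm⟩

/-- The group `K` fixes the end `ξ`, and its element `s` is a translation of length `l` along the
horoline `m`; all level shifts in `K` are multiples of `l`. -/
structure ActsAlong (P : ParentMap T ξ) (m : ℤ → V) (s : T ≃g T) (l : ℕ)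
    (K : Subgroup (T ≃g T)) : Prop where
  isHoroline : P.IsHoroline m
  pos : 0 < l
  fixes : ∀ k ∈ K, k • ξ = ξ
  mem : s ∈ K
  apply_line : ∀ i, s (m i) = m (i + l)
  dvd_shift : ∀ k ∈ K, (l : ℤ) ∣ P.shift k

/-- The union of the translates of a line under a group. -/
def lineOrbit (K : Subgroup (T ≃g T)) (m : ℤ → V) : Set V :=
  {v | ∃ k ∈ K, ∃ i, k (m i) = v}

namespace ActsAlong

variable {P : ParentMap T ξ} {m m' : ℤ → V} {s g : T ≃g T} {l : ℕ} {K K' : Subgroup (T ≃g T)}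

theorem shift_eq (h : P.ActsAlong m s l K) : P.shift s = l := by
  have := P.lev_apply (h.fixes s h.mem) (m 0)
  rw [h.apply_line, h.isHoroline.lev, h.isHoroline.lev] at this
  omega

theorem smul_bottom (h : P.ActsAlong m s l K) : s • h.isHoroline.bottom = h.isHoroline.bottom :=
  (h.isHoroline.smul_bottom_eq_iff h.isHoroline (h.fixes s h.mem)).2 fun i => by
    rw [h.shift_eq, h.apply_line]

theorem zpow_apply (h : P.ActsAlong m s l K) (q i : ℤ) : (s ^ q) (m i) = m (i + q * l) := by
  have h1 : s ^ q • h.isHoroline.bottom = h.isHoroline.bottom :=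
    (MulAction.stabilizer (T ≃g T) h.isHoroline.bottom).zpow_mem h.smul_bottom q
  have hs := h.fixes s h.mem
  rw [(h.isHoroline.smul_bottom_eq_iff h.isHoroline (smul_zpow_eq hs q)).1 h1,
    P.shift_zpow hs, h.shift_eq]

theorem exists_shift_mul_zpow (h : P.ActsAlong m s l K) {k : T ≃g T} (hk : k ∈ K) :
    ∃ q : ℤ, P.shift (k * s ^ q) = 0 ∧ k * s ^ q ∈ K := by
  have hs := h.fixes s h.mem
  obtain ⟨q, hq⟩ := h.dvd_shift k hk
  refine ⟨-q, ?_, K.mul_mem hk (K.zpow_mem h.mem _)⟩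
  rw [P.shift_mul (h.fixes k hk) (smul_zpow_eq hs _), P.shift_zpow hs, h.shift_eq, hq]
  ring

/-- A power of s, which preserves the line, cancels the shift of the transporting element. -/
theorem exists_of_mem_lineOrbit (h : P.ActsAlong m s l K) {v : V} (hv : v ∈ lineOrbit K m) :
    ∃ k ∈ K, P.shift k = 0 ∧ k (m (P.lev v)) = v := by
  obtain ⟨k, hk, i, rfl⟩ := hv
  obtain ⟨q, hq, hmem⟩ := h.exists_shift_mul_zpow hk
  refine ⟨_, hmem, hq, ?_⟩
  have hs := h.fixes s h.mem
  rw [P.shift_mul (h.fixes k hk) (smul_zpow_eq hs _), P.shift_zpow hs, h.shift_eq] at hq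
  rw [P.lev_apply (h.fixes k hk), h.isHoroline.lev, RelIso.mul_apply, h.zpow_apply,
    show i + P.shift k + q * l = i by linarith]

theorem mem_lineOrbit (K : Subgroup (T ≃g T)) (m : ℤ → V) (i : ℤ) : m i ∈ lineOrbit K m :=
  ⟨1, K.one_mem, i, rfl⟩

theorem isInvariant_lineOrbit (K : Subgroup (T ≃g T)) (m : ℤ → V) :
    IsInvariant K (lineOrbit K m) := by
  rintro g hg _ ⟨k, hk, i, rfl⟩
  exact ⟨g * k, K.mul_mem hg hk, i, rfl⟩

theorem up_mem_lineOrbit (h : P.ActsAlong m s l K) {v : V} (hv : v ∈ lineOrbit K m) :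
    P.up v ∈ lineOrbit K m := by
  obtain ⟨k, hk, i, rfl⟩ := hv
  exact ⟨k, hk, i + 1, by rw [← P.apply_up (h.fixes k hk), h.isHoroline.up]⟩

theorem isSubtree_lineOrbit (h : P.ActsAlong m s l K) : IsSubtree T (lineOrbit K m) :=
  P.isSubtree_of_up_mem ⟨_, mem_lineOrbit K m 0⟩ fun _ => h.up_mem_lineOrbit

/-- For `v` in the subtree, a low power of s makes `v` a descendant of m i and a high power lifts it
above level i; connectedness forces the subtree through m i. -/
theorem lineOrbit_subset (h : P.ActsAlong m s l K) {S : Set V} (hS : IsSubtree T S)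
    (hinv : IsInvariant K S) : lineOrbit K m ⊆ S := by
  rintro _ ⟨k, hk, i, rfl⟩
  refine hinv k hk _ ?_
  obtain ⟨⟨v, hv⟩⟩ := hS.nonempty
  obtain ⟨a, c, hac⟩ := P.join v (m i)
  have hl := congrArg P.lev hac
  rw [P.lev_iterate, P.lev_iterate, h.isHoroline.lev] at hl
  have hpos := h.pos
  have hq : ∀ q : ℤ, (s ^ q) v ∈ S := fun q => hinv _ (K.zpow_mem h.mem q) v hv
  have hs := h.fixes s h.mem
  refine P.mem_of_isSubtree hS (hq (-c)) (hq (a + 1)) ⟨(a + (l - 1) * c), ?_⟩ fun j hj => ?_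
  · rw [add_comm a, Function.iterate_add_apply, ← P.apply_iterate_up (smul_zpow_eq hs _), hac,
      h.isHoroline.iterate_up, h.zpow_apply, h.isHoroline.iterate_up]
    congr 1
    obtain ⟨l', rfl⟩ : ∃ l', l = l' + 1 := ⟨l - 1, by omega⟩
    push_cast
    ring_nf
  · have h1 := congrArg P.lev hj
    rw [P.lev_iterate, P.lev_apply (smul_zpow_eq hs _), P.shift_zpow hs, h.shift_eq,
      h.isHoroline.lev] at h1
    nlinarith

theorem minimalTree_eq (h : P.ActsAlong m s l K) : minimalTree K = lineOrbit K m :=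
  Set.Subset.antisymm (Set.sInter_subset_of_mem ⟨h.isSubtree_lineOrbit, isInvariant_lineOrbit K m⟩)
    (Set.subset_sInter fun _ hS => h.lineOrbit_subset hS.1 hS.2)

/-- By compactness, every horoline inside the union of the translates of `m` is itself a
translate of `m`. -/
theorem exists_apply_eq (h : P.ActsAlong m s l K) (hT : T.Connected) (hfin : IsLocallyFinite T)
    (hK : IsClosed (K : Set (T ≃g T))) (hm' : P.IsHoroline m')
    (hsub : ∀ i, m' i ∈ lineOrbit K m) :
    ∃ k ∈ K, P.shift k = 0 ∧ ∀ i, k (m i) = m' i := by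
  have habove : ∀ k ∈ K, ∀ i, k (m i) = m' i → P.shift k = 0 ∧ ∀ j ≥ i, k (m j) = m' j := by
    intro k hk i hi
    have h0 : P.shift k = 0 := by
      have := P.lev_apply (h.fixes k hk) (m i)
      rw [hi, h.isHoroline.lev, hm'.lev] at this
      omega
    refine ⟨h0, fun j hj => ?_⟩
    have h1 := (h.isHoroline.apply (h.fixes k hk)).eq_above hm' (i := i) (j := j)
    simp only [h0, sub_zero] at h1
    exact h1 hi hj
  -- Elements of K matching the two horolines at level −n match them above it, so these compact sets
  -- decrease with n; a common element matches them everywhere.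
  have hcpt : ∀ n : ℕ, IsCompact ({k : T ≃g T | k (m (-n)) = m' (-n)} ∩ K) := fun n =>
    (isCompact_apply_eq hT hfin _ _).inter_right hK
  obtain ⟨k, hk⟩ := IsCompact.nonempty_iInter_of_sequence_nonempty_isCompact_isClosed
    (fun n : ℕ => {k : T ≃g T | k (m (-n)) = m' (-n)} ∩ K)
    (fun n k hk => ⟨(habove k hk.2 _ hk.1).2 _ (by push_cast; omega), hk.2⟩)
    (fun n => by
      obtain ⟨k, hk, -, hk'⟩ := h.exists_of_mem_lineOrbit (hsub (-n))
      rw [hm'.lev] at hk'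
      exact ⟨k, hk', hk⟩)
    (hcpt 0) (fun n => (hcpt n).isClosed)
  rw [Set.mem_iInter] at hk
  refine ⟨k, (hk 0).2, (habove k (hk 0).2 _ (hk 0).1).1, fun i => ?_⟩
  exact (habove k (hk 0).2 _ (hk (-i).toNat).1).2 i (by omega)

/-- After cancelling the shift, an element fixes the line from some height on; conjugation by a
power of s lowers that height to `m i`. -/
theorem closure_eq (h : P.ActsAlong m s l K) (i : ℤ) :
    Subgroup.closure ({k | k (m i) = m i} ∩ K ∪ {s}) = K := by
  refine le_antisymm ((Subgroup.closure_le K).2 ?_) fun k hk => ?_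
  · rintro k (hk | rfl)
    exacts [hk.2, h.mem]
  obtain ⟨q, hq, hmem⟩ := h.exists_shift_mul_zpow hk
  set k₀ := k * s ^ q with hk₀
  have hfix := h.fixes k₀ hmem
  obtain ⟨a, ha⟩ := h.isHoroline.exists_fixes_above hfix hq i
  have h3 := h.isHoroline.fixes_above hfix ha (j := i + a * l) (by nlinarith [h.pos])
  have hs : s ∈ Subgroup.closure ({k | k (m i) = m i} ∩ K ∪ {s}) :=
    Subgroup.subset_closure (Or.inr rfl)
  have h4 : s ^ (-(a : ℤ)) * k₀ * s ^ (a : ℤ) ∈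
      Subgroup.closure ({k | k (m i) = m i} ∩ K ∪ {s}) := by
    refine Subgroup.subset_closure (Or.inl ⟨?_, ?_⟩)
    · change _ = _
      rw [RelIso.mul_apply, RelIso.mul_apply, h.zpow_apply, h3, h.zpow_apply]
      congr 1
      ring
    · exact K.mul_mem (K.mul_mem (K.zpow_mem h.mem _) hmem) (K.zpow_mem h.mem _)
  have h5 := mul_mem (mul_mem (mul_mem (zpow_mem hs a) h4) (zpow_mem hs (-a))) (zpow_mem hs (-q))
  convert h5 using 1
  rw [hk₀]
  group

theorem isCompactlyGenerated (h : P.ActsAlong m s l K) (hT : T.Connected)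
    (hfin : IsLocallyFinite T) (hK : IsClosed (K : Set (T ≃g T))) : IsCompactlyGenerated K :=
  ⟨_, ((isCompact_apply_eq hT hfin _ _).inter_right hK).union isCompact_singleton, h.closure_eq 0⟩

/-- If the stabilizer of a vertex of the line fixes the vertex `l` steps below, then the whole
group stabilizes the line. -/
theorem smul_bottom_of_fixes (h : P.ActsAlong m s l K) {i : ℤ}
    (hi : ∀ k ∈ K, k (m i) = m i → k (m (i - l)) = m (i - l)) :
    ∀ k ∈ K, k • h.isHoroline.bottom = h.isHoroline.bottom := by
  have hpos := h.pos
  suffices K ≤ MulAction.stabilizer (T ≃g T) h.isHoroline.bottom from fun k hk => this hk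
  refine (h.closure_eq i).symm.le.trans ((Subgroup.closure_le _).2 ?_)
  rintro k (⟨hk, hkK⟩ | rfl)
  swap
  · exact h.smul_bottom
  have hfix := h.fixes k hkK
  have h0 := P.shift_eq_zero_of_fixes hfix hk
  -- Conjugation by sⁿ carries the hypothesis at m i down to m (i − nl), so fixing propagates
  -- downwards in steps of l.
  have h1 : ∀ n : ℕ, k (m (i - n * l)) = m (i - n * l) := by
    intro n
    induction n with
    | zero => simpa using hk
    | succ n ih =>
      have h2 := hi (s ^ (n : ℤ) * k * s ^ (-(n : ℤ)))
        (K.mul_mem (K.mul_mem (K.zpow_mem h.mem _) hkK) (K.zpow_mem h.mem _))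
        (by
          rw [RelIso.mul_apply, RelIso.mul_apply, h.zpow_apply,
            show i + -(n : ℤ) * l = i - n * l by ring, ih, h.zpow_apply]
          congr 1
          ring)
      rw [RelIso.mul_apply, RelIso.mul_apply, h.zpow_apply,
        show i - l + -(n : ℤ) * l = i - (n + 1 : ℕ) * l by push_cast; ring] at h2
      have h3 := congrArg (s ^ (-(n : ℤ))) h2
      rw [← RelIso.mul_apply (s ^ (-(n : ℤ))), ← zpow_add, neg_add_cancel, zpow_zero,
        RelIso.one_apply, h.zpow_apply] at h3
      rw [h3]
      congr 1
      push_cast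
      ring
  refine (h.isHoroline.smul_bottom_eq_iff h.isHoroline hfix).2 fun j => ?_
  rw [h0, add_zero]
  refine h.isHoroline.fixes_above hfix (h1 (i - j).toNat) ?_
  have h3 : i - j ≤ (i - j).toNat := Int.self_le_toNat _
  nlinarith

end ActsAlong

end ParentMap

end TreeFocal

namespace TreeFocal

variable {V : Type*} {T : SimpleGraph V} {ξ : TreeEnd T}

/-! ### The action on the minimal tree. -/

namespace ParentMap

/-- A horoline inside a set `S`, as a line in the induced graph. -/
def IsHoroline.inducedLine {P : ParentMap T ξ} {m : ℤ → V} (hm : P.IsHoroline m) (S : Set V)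
    (hS : ∀ i, m i ∈ S) : Line (T.induce S) where
  toFun i := ⟨m i, hS i⟩
  adj := hm.toLine.adj
  inj _ _ h := hm.injective (congrArg Subtype.val h)

/-- A lower tail of the horoline lies in `S`, and closure under parents adds the rest. -/
theorem IsHoroline.mem_of_bottom_eq {P : ParentMap T ξ} {m : ℤ → V} (hm : P.IsHoroline m)
    {S : Set V} (hS : ∀ v ∈ S, P.up v ∈ S) {e : TreeEnd (T.induce S)}
    (he : inducedEnd S e = hm.bottom) (i : ℤ) : m i ∈ S := by
  induction e using Quotient.inductionOn with | h r => ?_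
  obtain ⟨a, b, hab⟩ := Quotient.exact he
  have h1 : ∀ k : ℕ, m (-((b + k : ℕ) : ℤ)) ∈ S := fun k => by
    have h2 : (r.toFun (a + k) : V) = m (-((b + k : ℕ) : ℤ)) := hab k
    rw [← h2]
    exact (r.toFun (a + k)).2
  have h2 : ∀ n : ℕ, m (-((b + (-b - i).toNat : ℕ) : ℤ) + n) ∈ S := fun n => by
    induction n with
    | zero =>
      rw [Nat.cast_zero, add_zero]
      exact h1 _
    | succ n ih =>
      have := hS _ ih
      rw [hm.up] at this
      push_cast at this ⊢
      rwa [← add_assoc]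
  have h3 := h2 (i + (b + (-b - i).toNat)).toNat
  rwa [show -((b + (-b - i).toNat : ℕ) : ℤ) + (i + (b + (-b - i).toNat)).toNat = i by omega] at h3

namespace ActsAlong

variable {P : ParentMap T ξ} {m : ℤ → V} {s : T ≃g T} {l : ℕ} {K : Subgroup (T ≃g T)}

theorem leafless_lineOrbit (h : P.ActsAlong m s l K) : Leafless (T.induce (lineOrbit K m)) := by
  rintro ⟨_, k, hk, i, rfl⟩ h1
  obtain ⟨x, hx⟩ := Set.encard_eq_one.1 h1
  have hadj : ∀ j, T.Adj (m i) (m j) → (⟨k (m j), k, hk, j, rfl⟩ : lineOrbit K m) = x := by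
    intro j hj
    have : (⟨k (m j), k, hk, j, rfl⟩ : lineOrbit K m) ∈ ({x} : Set (lineOrbit K m)) := by
      rw [← hx]
      exact k.map_rel_iff.2 hj
    exact this
  have h2 := hadj (i + 1) (h.isHoroline.toLine.adj i)
  have h3 := hadj (i - 1) (by
    have := h.isHoroline.toLine.adj (i - 1)
    rw [sub_add_cancel] at this
    exact this.symm)
  have h4 := h.isHoroline.injective (k.injective (congrArg Subtype.val (h2.trans h3.symm)))
  omega

/-- The end of the union of the translates of `m` that corresponds to `ξ`. -/
def topEnd (h : P.ActsAlong m s l K) : TreeEnd (T.induce (lineOrbit K m)) :=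
  (h.isHoroline.inducedLine _ (mem_lineOrbit K m)).posRay.toEnd

theorem inducedEnd_topEnd (h : P.ActsAlong m s l K) : inducedEnd _ h.topEnd = ξ :=
  h.isHoroline.toEnd_posRay

theorem exists_inducedEnd_eq (h : P.ActsAlong m s l K) {k : T ≃g T} (hk : k ∈ K) :
    ∃ e : TreeEnd (T.induce (lineOrbit K m)), inducedEnd _ e = k • h.isHoroline.bottom := by
  have hm := h.isHoroline.apply (h.fixes k hk)
  refine ⟨(hm.inducedLine (lineOrbit K m) fun i => ⟨k, hk, _, rfl⟩).negRay.toEnd, ?_⟩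
  rw [← h.isHoroline.bottom_apply (h.fixes k hk)]
  rfl

/-- An end other than the top one is the bottom of a horoline inside the orbit, hence a K-translate
of the bottom of `m` by `exists_apply_eq`. -/
theorem isAlmostBoundaryTransitive (h : P.ActsAlong m s l K) (hT : T.IsTree)
    (hfin : IsLocallyFinite T) (hK : IsClosed (K : Set (T ≃g T)))
    (hS : IsInvariant K (lineOrbit K m)) :
    IsAlmostBoundaryTransitive (restrictAction K _ hS) h.topEnd where
  isTree := ⟨h.isSubtree_lineOrbit, hT.isAcyclic.induce _⟩
  locallyFinite v := Set.Finite.preimage Subtype.val_injective.injOn (hfin v)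
  leafless := h.leafless_lineOrbit
  closed_range :=
    isClosed_range_restrictAction hT.connected hfin hK ⟨_, mem_lineOrbit K m 0⟩ hS
  fixes k := inducedEnd_injective _ <| by
    rw [inducedEnd_restrictAction_smul, h.inducedEnd_topEnd, h.fixes k k.2]
  transitive := by
    have key : ∀ e, e ≠ h.topEnd →
        ∃ k : K, (k : T ≃g T) • h.isHoroline.bottom = inducedEnd _ e := by
      intro e he
      have he' : inducedEnd _ e ≠ ξ := fun h' =>
        he (inducedEnd_injective _ (h'.trans h.inducedEnd_topEnd.symm))
      obtain ⟨m', hm', hb⟩ := P.exists_horoline he'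
      obtain ⟨k, hk, h0, hkm⟩ := h.exists_apply_eq hT.connected hfin hK hm'
        (hm'.mem_of_bottom_eq (fun _ => h.up_mem_lineOrbit) hb.symm)
      refine ⟨⟨k, hk⟩, ?_⟩
      rw [← hb]
      exact (h.isHoroline.smul_bottom_eq_iff hm' (h.fixes k hk)).2 fun i => by
        rw [h0, hkm, add_zero]
    intro e e' he he'
    obtain ⟨k, hk⟩ := key e he
    obtain ⟨k', hk'⟩ := key e' he'
    refine ⟨k' * k⁻¹, inducedEnd_injective _ ?_⟩
    rw [inducedEnd_restrictAction_smul, ← hk, ← hk', ← mul_smul]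
    simp

theorem isTranslation_restrictAction (h : P.ActsAlong m s l K)
    (hS : IsInvariant K (lineOrbit K m)) :
    IsTranslation (restrictAction K _ hS ⟨s, h.mem⟩) l :=
  ⟨_, h.pos, h.isHoroline.inducedLine _ (mem_lineOrbit K m), rfl,
    fun i => Subtype.ext (h.apply_line i)⟩

/-- By transitivity, a fixed end other than the top one would be the bottom of `m`, which some
element of K moves. -/
theorem isFocal (h : P.ActsAlong m s l K) (hT : T.IsTree)
    (hfin : IsLocallyFinite T) (hK : IsClosed (K : Set (T ≃g T)))
    (hS : IsInvariant K (lineOrbit K m))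
    (hne : ∃ k ∈ K, k • h.isHoroline.bottom ≠ h.isHoroline.bottom) :
    IsFocal (restrictAction K _ hS) h.topEnd where
  toIsAlmostBoundaryTransitive := h.isAlmostBoundaryTransitive hT hfin hK hS
  exists_translation := ⟨_, _, h.isTranslation_restrictAction hS⟩
  unique_fixed e he := by
    by_contra hcon
    obtain ⟨e₀, he₀⟩ := h.exists_inducedEnd_eq K.one_mem
    rw [one_smul] at he₀
    have htop : e₀ ≠ h.topEnd := fun h' => h.isHoroline.bottom_ne <| by
      rw [← he₀, h', h.inducedEnd_topEnd]
    obtain ⟨k, hk⟩ := (h.isAlmostBoundaryTransitive hT hfin hK hS).transitive e e₀ hcon htop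
    obtain rfl : e = e₀ := (he k).symm.trans hk
    obtain ⟨g, hg, hg'⟩ := hne
    refine hg' ?_
    rw [← he₀, ← inducedEnd_restrictAction_smul hS ⟨g, hg⟩, he]

theorem isMinTranslationLength (h : P.ActsAlong m s l K) (hS : IsInvariant K (lineOrbit K m)) :
    IsMinTranslationLength (restrictAction K _ hS) l := by
  refine ⟨⟨_, h.isTranslation_restrictAction hS⟩, ?_⟩
  rintro n ⟨k, hk⟩
  have hk' := isTranslation_of_restrictAction hS hk
  have h1 := P.natAbs_shift_of_isTranslation (h.fixes k k.2) hk'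
  have h2 : 0 < n := hk.choose_spec.1
  have h3 := Int.natAbs_dvd_natAbs.2 (h.dvd_shift k k.2)
  rw [h1] at h3
  exact Nat.le_of_dvd h2 h3

theorem isScaleGroupAction (h : P.ActsAlong m s l K) (hT : T.IsTree)
    (hfin : IsLocallyFinite T) (hK : IsClosed (K : Set (T ≃g T)))
    (hS : IsInvariant K (lineOrbit K m))
    (hne : ∃ k ∈ K, k • h.isHoroline.bottom ≠ h.isHoroline.bottom) (hl : l = 1) :
    IsScaleGroupAction (restrictAction K _ hS) where
  topologicalGroup := inferInstance
  t2 := inferInstance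
  locallyCompact :=
    have := locallyCompactSpace_aut hT.connected hfin
    hK.isClosedEmbedding_subtypeVal.locallyCompactSpace
  totallyDisconnected := inferInstance
  continuous v w := by
    have : {g : K | restrictAction K _ hS g v = w} =
        Subtype.val ⁻¹' {g : T ≃g T | g v = w} := by
      ext g
      exact Subtype.ext_iff
    rw [this]
    exact (isOpen_apply_eq _ _).preimage continuous_subtype_val
  proper v w := by
    have : {g : K | restrictAction K _ hS g v = w} =
        Subtype.val ⁻¹' {g : T ≃g T | g v = w} := by
      ext g
      exact Subtype.ext_iff
    rw [this]
    exact hK.isClosedEmbedding_subtypeVal.isCompact_preimage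
      (isCompact_apply_eq hT.connected hfin _ _)
  -- Since l = 1, the powers of s are already transitive on the vertices of the line.
  vertexTransitive := by
    rintro ⟨_, k, hk, i, rfl⟩ ⟨_, k', hk', j, rfl⟩
    refine ⟨⟨k' * s ^ (j - i) * k⁻¹, K.mul_mem (K.mul_mem hk' (K.zpow_mem h.mem _))
      (K.inv_mem hk)⟩, Subtype.ext ?_⟩
    change (k' * s ^ (j - i) * k⁻¹) (k (m i)) = k' (m j)
    rw [← RelIso.mul_apply _ k, inv_mul_cancel_right, RelIso.mul_apply, h.zpow_apply, hl]
    congr 2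
    push_cast
    ring
  almostBoundaryTransitive := ⟨_, h.isAlmostBoundaryTransitive hT hfin hK hS⟩
  moreThanTwoEnds := by
    obtain ⟨k, hk, hk'⟩ := hne
    obtain ⟨e₀, he₀⟩ := h.exists_inducedEnd_eq K.one_mem
    obtain ⟨e₁, he₁⟩ := h.exists_inducedEnd_eq hk
    rw [one_smul] at he₀
    refine ⟨h.topEnd, e₀, e₁, ?_, ?_, ?_⟩
    · rintro rfl
      exact h.isHoroline.bottom_ne (he₀.symm.trans h.inducedEnd_topEnd)
    · rintro rfl
      rw [h.inducedEnd_topEnd, eq_comm, smul_eq_iff_eq_inv_smul,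
        (inv_smul_eq_iff.2 (h.fixes k hk).symm)] at he₁
      exact h.isHoroline.bottom_ne he₁
    · rintro rfl
      exact hk' (he₁.symm.trans he₀)

end ActsAlong

end ParentMap

end TreeFocal

namespace TreeFocal

variable {V : Type*} {T : SimpleGraph V} {ξ : TreeEnd T}

/-! ### Structure of H, recovery of K, thinness and minimal overgroups. -/

namespace ParentMap

variable {P : ParentMap T ξ} {m : ℤ → V} {s : T ≃g T} {l : ℕ} {G K K' U : Subgroup (T ≃g T)}

/-- A shortest translation, inverted if necessary, moves its axis towards ξ; conjugating by an
element that carries the lower end of the axis to ξ' keeps its shift. -/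
theorem exists_mem_endStabilizer_shift_eq (P : ParentMap T ξ) (hG : IsFocal G.subtype ξ)
    (hl : IsMinTranslationLength G.subtype l) {ξ' : TreeEnd T} (hξ' : ξ' ≠ ξ) :
    0 < l ∧ ∃ s ∈ endStabilizer G ξ', P.shift s = l := by
  have hfix : ∀ g ∈ G, g • ξ = ξ := fun g hg => hG.fixes ⟨g, hg⟩
  obtain ⟨⟨g, hg⟩, htr⟩ := hl.1
  have hpos : 0 < l := htr.choose_spec.1
  have habs : (P.shift g).natAbs = l := P.natAbs_shift_of_isTranslation (hfix g hg) htr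
  obtain ⟨g, hg, hgl⟩ : ∃ g ∈ G, P.shift g = l := by
    obtain h | h := Int.natAbs_eq (P.shift g)
    · exact ⟨g, hg, by omega⟩
    · exact ⟨g⁻¹, G.inv_mem hg, by rw [P.shift_inv (hfix g hg)]; omega⟩
  refine ⟨hpos, ?_⟩
  obtain ⟨m, hm, hgm⟩ := P.exists_axis (hfix g hg) (by omega)
  obtain ⟨⟨k, hk⟩, hkm⟩ := hG.transitive hm.bottom ξ' hm.bottom_ne hξ'
  replace hkm : k • hm.bottom = ξ' := hkm
  have hgb : g • hm.bottom = hm.bottom := (hm.smul_bottom_eq_iff hm (hfix g hg)).2 hgm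
  have hk' : k⁻¹ • ξ = ξ := hfix _ (G.inv_mem hk)
  refine ⟨k * g * k⁻¹, ⟨G.mul_mem (G.mul_mem hk hg) (G.inv_mem hk), ?_⟩, ?_⟩
  · change (k * g * k⁻¹) • ξ' = ξ'
    rw [← hkm, mul_smul, inv_smul_smul, mul_smul, hgb]
  · rw [P.shift_mul (by rw [mul_smul, hfix g hg, hfix k hk]) hk',
      P.shift_mul (hfix k hk) (hfix g hg), P.shift_inv (hfix k hk), hgl]
    ring

/-- Euclidean division: a nonzero remainder would be the length of a translation k s⁻ᵠ shorter than
l. -/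
theorem dvd_shift (P : ParentMap T ξ) (hfix : ∀ g ∈ G, g • ξ = ξ)
    (hl : IsMinTranslationLength G.subtype l) (hpos : 0 < l) (hs : s ∈ G) (hsl : P.shift s = l)
    {k : T ≃g T} (hk : k ∈ G) : (l : ℤ) ∣ P.shift k := by
  by_contra hdvd
  set q := P.shift k / l
  set g := k * s ^ (-q)
  have hg : g ∈ G := G.mul_mem hk (G.zpow_mem hs _)
  have hgs : P.shift g = P.shift k % l := by
    rw [P.shift_mul (hfix k hk) (smul_zpow_eq (hfix s hs) _), P.shift_zpow (hfix s hs), hsl,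
      Int.emod_def]
    ring
  have h1 := Int.emod_nonneg (P.shift k) (b := l) (by omega)
  have h2 := Int.emod_lt_of_pos (P.shift k) (b := l) (by omega)
  have h3 : P.shift k % l ≠ 0 := fun h => hdvd (Int.dvd_of_emod_eq_zero h)
  obtain ⟨m, hm, hgm⟩ := P.exists_axis (hfix g hg) (by omega)
  have h4 : IsTranslation g (P.shift g).toNat :=
    ⟨ξ, hm.isTranslationToward (by omega) fun i => by rw [hgm, Int.toNat_of_nonneg (by omega)]⟩
  have h5 := hl.2 ⟨⟨g, hg⟩, h4⟩
  omega

theorem mem_fixator_range_iff (hm : P.IsHoroline m) (hfix : ∀ g ∈ G, g • ξ = ξ) {g : T ≃g T} :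
    g ∈ fixator G (Set.range m) ↔ g ∈ endStabilizer G hm.bottom ∧ P.shift g = 0 := by
  constructor
  · rintro ⟨hg, hg'⟩
    have h1 : ∀ i, g (m i) = m i := fun i => (mem_fixingSubgroup_iff _).1 hg' _ ⟨i, rfl⟩
    have h0 := P.shift_eq_zero_of_fixes (hfix g hg) (h1 0)
    refine ⟨⟨hg, (hm.smul_bottom_eq_iff hm (hfix g hg)).2 fun i => ?_⟩, h0⟩
    rw [h0, add_zero, h1]
  · rintro ⟨⟨hg, hg'⟩, h0⟩
    refine ⟨hg, (mem_fixingSubgroup_iff _).2 ?_⟩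
    rintro _ ⟨i, rfl⟩
    have := (hm.smul_bottom_eq_iff hm (hfix g hg)).1 hg' i
    rwa [h0, add_zero] at this

/-- The shift maps H onto lℤ with kernel the fixator of the line, and s splits it. -/
theorem isSemidirectCyclic (hm : P.IsHoroline m) (hfix : ∀ g ∈ G, g • ξ = ξ)
    (hs : s ∈ endStabilizer G hm.bottom) (hsl : P.shift s = l) (hpos : 0 < l)
    (hdvd : ∀ k ∈ G, (l : ℤ) ∣ P.shift k) :
    IsSemidirectCyclic (endStabilizer G hm.bottom) (fixator G (Set.range m)) s := by
  have hinj : ∀ q : ℤ, P.shift (s ^ q) = q * l := fun q => by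
    rw [P.shift_zpow (hfix s hs.1), hsl]
  refine ⟨⟨fun n hn g => ?_⟩, le_antisymm (sup_le ?_ ?_) fun g hg => ?_, ?_, fun a b hab => ?_⟩
  · rw [Subgroup.mem_subgroupOf, mem_fixator_range_iff hm hfix] at hn ⊢
    refine ⟨(g * n * g⁻¹).2, ?_⟩
    have hg := hfix g g.2.1
    have hn' := hfix n n.2.1
    push_cast
    rw [P.shift_mul (by rw [mul_smul, hn', hg]) (inv_smul_eq_iff.2 hg.symm),
      P.shift_mul hg hn', P.shift_inv hg, hn.2]
    ring
  · exact fun g hg => ((mem_fixator_range_iff hm hfix).1 hg).1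
  · rw [Subgroup.zpowers_le]
    exact hs
  · obtain ⟨q, hq⟩ := hdvd g hg.1
    have h1 : g * s ^ (-q) ∈ fixator G (Set.range m) := by
      refine (mem_fixator_range_iff hm hfix).2 ⟨mul_mem hg (zpow_mem hs _), ?_⟩
      rw [P.shift_mul (hfix g hg.1) (smul_zpow_eq (hfix s hs.1) _), hinj, hq]
      ring
    have h2 := Subgroup.mul_mem_sup h1 (Subgroup.zpow_mem_zpowers s q)
    rwa [mul_assoc, ← zpow_add, neg_add_cancel, zpow_zero, mul_one] at h2
  · rw [eq_bot_iff]
    rintro g ⟨hg, q, rfl⟩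
    have h1 := ((mem_fixator_range_iff hm hfix).1 hg).2
    rw [hinj] at h1
    obtain rfl : q = 0 := by
      rcases mul_eq_zero.1 h1 with h | h <;> omega
    exact Subgroup.mem_bot.2 (zpow_zero s)
  · have h1 := congrArg P.shift hab
    simp only [hinj] at h1
    exact mul_right_cancel₀ (by omega) h1

namespace ActsAlong

/-- For k in K, the translate of the line by k is also a translate by some k' in K'; then k'⁻¹k
fixes the bottom end, so it lies in H ≤ K'. -/
theorem le_of_lineOrbit_subset (h : P.ActsAlong m s l K) (h' : P.ActsAlong m s l K')
    (hT : T.Connected) (hfin : IsLocallyFinite T) (hK' : IsClosed (K' : Set (T ≃g T)))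
    (hKG : K ≤ G) (hKG' : K' ≤ G) (hH : endStabilizer G h.isHoroline.bottom ≤ K')
    (hsub : lineOrbit K m ⊆ lineOrbit K' m) : K ≤ K' := by
  intro k hk
  have hfix := h.fixes k hk
  have hm := h.isHoroline.apply hfix
  obtain ⟨k', hk', h0, hkm⟩ := h'.exists_apply_eq hT hfin hK' hm
    fun i => hsub ⟨k, hk, _, rfl⟩
  have h1 : k' • h.isHoroline.bottom = k • h.isHoroline.bottom := by
    rw [← h.isHoroline.bottom_apply hfix]
    exact (h.isHoroline.smul_bottom_eq_iff hm (h'.fixes k' hk')).2 fun i => by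
      rw [h0, add_zero, hkm]
  have h2 : k'⁻¹ * k ∈ K' := hH ⟨G.mul_mem (G.inv_mem (hKG' hk')) (hKG hk), by
    change (k'⁻¹ * k) • _ = _
    rw [mul_smul, ← h1, inv_smul_smul]⟩
  have h3 := K'.mul_mem hk' h2
  rwa [mul_inv_cancel_left] at h3

theorem smul_bottom_of_lineOrbit_subset (h : P.ActsAlong m s l K)
    (hsub : lineOrbit K m ⊆ Set.range m) {k : T ≃g T} (hk : k ∈ K) :
    k • h.isHoroline.bottom = h.isHoroline.bottom := by
  refine (h.isHoroline.smul_bottom_eq_iff h.isHoroline (h.fixes k hk)).2 fun i => ?_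
  obtain ⟨j, hj⟩ := hsub ⟨k, hk, i, rfl⟩
  have h1 := congrArg P.lev hj
  rw [P.lev_apply (h.fixes k hk), h.isHoroline.lev, h.isHoroline.lev] at h1
  rw [← hj, h1]

theorem exists_not_fixes_below (h : P.ActsAlong m s l K)
    (hne : ∃ k ∈ K, k • h.isHoroline.bottom ≠ h.isHoroline.bottom) (i : ℤ) :
    ∃ k ∈ K, k (m i) = m i ∧ k (m (i - l)) ≠ m (i - l) := by
  by_contra! hcon
  obtain ⟨k, hk, hk'⟩ := hne
  exact hk' (h.smul_bottom_of_fixes hcon k hk)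

theorem inv_apply_line (h : P.ActsAlong m s l K) (i : ℤ) : s⁻¹ (m i) = m (i - l) := by
  have := h.zpow_apply (-1) i
  rw [zpow_neg_one] at this
  rw [this]
  congr 1
  ring

end ActsAlong

/-- A compact group fixing the distinguished end shifts no levels. -/
theorem shift_eq_zero_of_isCompact (P : ParentMap T ξ) (hfix : ∀ g ∈ U, g • ξ = ξ)
    (hU : IsCompact (U : Set (T ≃g T))) {u : T ≃g T} (hu : u ∈ U) : P.shift u = 0 := by
  obtain ⟨N, hN⟩ := hU.elim_directed_cover (fun n : ℕ => {g : T ≃g T | P.shift g ≤ n})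
    (fun n => isOpen_of_local (v := P.ray.toFun 0) fun g hg k hk => by
      simp only [Set.mem_ofPred_eq, shift] at hg ⊢
      rwa [hk])
    (fun g _ => Set.mem_iUnion.2 ⟨(P.shift g).toNat, Int.self_le_toNat _⟩)
    (directed_of_isDirected_le fun a b hab g (hg : P.shift g ≤ a) =>
      hg.trans (by exact_mod_cast hab))
  have hle : ∀ g ∈ U, P.shift g ≤ 0 := by
    intro g hg
    -- With N bounding the shift on U, a shift of at least 1 would give g^(N+1) a shift above N.
    have h1 : P.shift (g ^ ((N + 1 : ℕ) : ℤ)) ≤ N := hN (U.zpow_mem hg _)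
    rw [P.shift_zpow (hfix g hg)] at h1
    push_cast at h1
    by_contra! h2
    nlinarith
  have h1 := hle u hu
  have h2 := hle _ (U.inv_mem hu)
  rw [P.shift_inv (hfix u hu)] at h2
  omega

/-- Each element fixes the line from some height on, and compactness makes the height uniform. -/
theorem exists_forall_fixes_of_isCompact (hm : P.IsHoroline m) (hfix : ∀ g ∈ U, g • ξ = ξ)
    (hU : IsCompact (U : Set (T ≃g T))) : ∃ i, ∀ u ∈ U, u (m i) = m i := by
  obtain ⟨t, ht⟩ := hU.elim_finite_subcover (fun n : ℕ => {g : T ≃g T | g (m n) = m n})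
    (fun n => isOpen_apply_eq _ _) (fun g hg => by
      obtain ⟨a, ha⟩ := hm.exists_fixes_above (hfix g hg)
        (P.shift_eq_zero_of_isCompact hfix hU hg) 0
      exact Set.mem_iUnion.2 ⟨a, by simpa using ha⟩)
  refine ⟨(t.sup id : ℕ), fun u hu => ?_⟩
  obtain ⟨n, hn, hun⟩ := Set.mem_iUnion₂.1 (ht hu)
  exact hm.fixes_above (hfix u hu) hun (by exact_mod_cast Finset.le_sup (f := id) hn)

/-- An open subgroup that contains the fixator of a horoline contains the stabilizer of some
vertex of it. -/
theorem exists_stabilizer_le (hm : P.IsHoroline m) (hT : T.Connected) (hfin : IsLocallyFinite T)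
    (hG : IsClosed (G : Set (T ≃g T))) (hfix : ∀ g ∈ G, g • ξ = ξ)
    (hU : IsOpen (U.subgroupOf G : Set G)) (hfU : fixator G (Set.range m) ≤ U) :
    ∃ i, ∀ g ∈ G, g (m i) = m i → g ∈ U := by
  obtain ⟨O, hO, hOU⟩ := isOpen_induced_iff.1 hU
  have hmem : ∀ g (hg : g ∈ G), g ∈ O ↔ g ∈ U := fun g hg => by
    have : (⟨g, hg⟩ : G) ∈ Subtype.val ⁻¹' O ↔ (⟨g, hg⟩ : G) ∈ (U.subgroupOf G : Set G) := by
      rw [hOU]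
    exact this
  by_contra! hcon
  -- If every vertex stabilizer left U, these decreasing compact sets would share an element outside
  -- U fixing the whole line.
  have hcpt : ∀ n : ℕ, IsCompact ({g : T ≃g T | g (m (-n)) = m (-n)} ∩ (G ∩ Oᶜ)) := fun n =>
    (isCompact_apply_eq hT hfin _ _).inter_right (hG.inter hO.isClosed_compl)
  obtain ⟨g, hg⟩ := IsCompact.nonempty_iInter_of_sequence_nonempty_isCompact_isClosed
    (fun n : ℕ => {g : T ≃g T | g (m (-n)) = m (-n)} ∩ (G ∩ Oᶜ))
    (fun n g hg => ⟨hm.fixes_above (hfix g hg.2.1) hg.1 (by push_cast; omega), hg.2⟩)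
    (fun n => by
      obtain ⟨g, hg, h1, h2⟩ := hcon (-n)
      exact ⟨g, h1, hg, fun h => h2 ((hmem g hg).1 h)⟩)
    (hcpt 0) (fun n => (hcpt n).isClosed)
  rw [Set.mem_iInter] at hg
  have hgG := (hg 0).2.1
  refine (hg 0).2.2 ((hmem g hgG).2 (hfU ⟨hgG, (mem_fixingSubgroup_iff _).2 ?_⟩))
  rintro _ ⟨i, rfl⟩
  exact hm.fixes_above (hfix g hgG) (hg (-i).toNat).1 (by omega)

/-- If (K ∩ U)H is a group M, the local criterion applies to M because U fixes a vertex of the line;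
so M fixes the bottom end. But U contains the G-stabilizer of some m j, hence M contains an element
of K fixing m j and moving m (j − l). -/
theorem ActsAlong.not_isThin (h : P.ActsAlong m s l K) (hT : T.Connected)
    (hfin : IsLocallyFinite T) (hG : IsClosed (G : Set (T ≃g T))) (hKG : K ≤ G)
    (hfix : ∀ g ∈ G, g • ξ = ξ) (hs : s ∈ endStabilizer G h.isHoroline.bottom)
    (hHK : endStabilizer G h.isHoroline.bottom ≤ K)
    (hne : ∃ k ∈ K, k • h.isHoroline.bottom ≠ h.isHoroline.bottom)
    (hUG : U ≤ G) (hfU : fixator G (Set.range m) ≤ U) (hUc : IsCompact (U : Set (T ≃g T)))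
    (hUo : IsOpen (U.subgroupOf G : Set G)) :
    ¬ IsThin U K (endStabilizer G h.isHoroline.bottom) := by
  rintro ⟨M, hM, -⟩
  have hm := h.isHoroline
  have hMmem : ∀ {g}, g ∈ M ↔ ∃ u ∈ K ⊓ U, ∃ k ∈ endStabilizer G hm.bottom, u * k = g := by
    intro g
    rw [← SetLike.mem_coe, hM, Set.mem_mul]
    rfl
  have hMK : M ≤ K := fun g hg => by
    obtain ⟨u, hu, k, hk, rfl⟩ := hMmem.1 hg
    exact K.mul_mem hu.1 (hHK hk)
  have hA : P.ActsAlong m s l M :=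
    ⟨hm, h.pos, fun k hk => h.fixes k (hMK hk), hMmem.2 ⟨1, one_mem _, s, hs, one_mul s⟩,
      h.apply_line, fun k hk => h.dvd_shift k (hMK hk)⟩
  have hfixU : ∀ u ∈ U, u • ξ = ξ := fun u hu => hfix u (hUG hu)
  obtain ⟨i, hi⟩ := exists_forall_fixes_of_isCompact hm hfixU hUc
  have hMb := hA.smul_bottom_of_fixes (i := i + l) (by
    intro g hg hgi
    obtain ⟨u, hu, k, hk, rfl⟩ := hMmem.1 hg
    have h0 := P.shift_eq_zero_of_fixes (h.fixes _ (hMK hg)) hgi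
    rw [P.shift_mul (hfixU u hu.2) (hfix k hk.1), P.shift_eq_zero_of_isCompact hfixU hUc hu.2,
      zero_add] at h0
    have h1 := (hm.smul_bottom_eq_iff hm (hfix k hk.1)).1 hk.2 i
    rw [h0, add_zero] at h1
    -- Here k has shift 0, so it fixes the line pointwise, while u fixes m i.
    rw [add_sub_cancel_right, RelIso.mul_apply, h1, hi u hu.2])
  obtain ⟨j, hj⟩ := exists_stabilizer_le hm hT hfin hG hfix hUo hfU
  obtain ⟨k, hk, hkj, hk'⟩ := h.exists_not_fixes_below hne j
  have hkM : k ∈ M := hMmem.2 ⟨k, ⟨hk, hj k (hKG hk) hkj⟩, 1, one_mem _, mul_one k⟩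
  have h1 := (hm.smul_bottom_eq_iff hm (h.fixes k hk)).1 (hMb k hkM) (j - l)
  rw [P.shift_eq_zero_of_fixes (h.fixes k hk) hkj, add_zero] at h1
  exact hk' h1

/-- Every closed group properly containing the stabilizer of a horoline contains a minimal one. -/
theorem exists_minimal_closedOvergroup (hm : P.IsHoroline m) (hT : T.Connected)
    (hfin : IsLocallyFinite T)
    (hA : ∀ N ∈ closedOvergroups G (endStabilizer G hm.bottom), P.ActsAlong m s l N)
    (hK : K ∈ closedOvergroups G (endStabilizer G hm.bottom))
    (hne : K ≠ endStabilizer G hm.bottom) :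
    ∃ M ≤ K, Minimal (fun N => N ∈ closedOvergroups G (endStabilizer G hm.bottom) ∧
      N ≠ endStabilizer G hm.bottom) M := by
  set H := endStabilizer G hm.bottom with hH
  have hmove : ∀ N, N ∈ closedOvergroups G H ∧ N ≠ H →
      ∃ k ∈ N, k (m 0) = m 0 ∧ k (m (0 - l)) ≠ m (0 - l) := by
    rintro N ⟨hN, hNH⟩
    refine (hA N hN).exists_not_fixes_below ?_ 0
    by_contra! hcon
    exact hNH (le_antisymm (fun k hk => ⟨hN.2.2 hk, hcon k hk⟩) hN.2.1)
  obtain ⟨M, hMK, hM⟩ := zorn_le_nonempty₀ (α := (Subgroup (T ≃g T))ᵒᵈ)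
    {N | OrderDual.ofDual N ∈ closedOvergroups G H ∧ OrderDual.ofDual N ≠ H} (by
      intro C hC hchain N₀ hN₀
      -- These compact sets consist of the elements witnessing that a member of the chain is not H.
      -- They are nested and nonempty, so a common element witnesses it for the intersection.
      let t : C → Set (T ≃g T) := fun N => {k : T ≃g T | k (m 0) = m 0} ∩
        ((OrderDual.ofDual N.1 : Subgroup (T ≃g T)) ∩ {k : T ≃g T | k (m (0 - l)) = m (0 - l)}ᶜ)
      have : Nonempty C := ⟨⟨N₀, hN₀⟩⟩
      have htc : ∀ N, IsCompact (t N) := fun N => (isCompact_apply_eq hT hfin _ _).inter_right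
        ((hC N.2).1.1.inter (isOpen_apply_eq _ _).isClosed_compl)
      obtain ⟨k, hk⟩ := IsCompact.nonempty_iInter_of_directed_nonempty_isCompact_isClosed t
        (by
          intro N N'
          obtain hle | hle := hchain.total N.2 N'.2
          · exact ⟨N', fun k hk => ⟨hk.1, hle hk.2.1, hk.2.2⟩, subset_rfl⟩
          · exact ⟨N, subset_rfl, fun k hk => ⟨hk.1, hle hk.2.1, hk.2.2⟩⟩)
        (fun N => by
          obtain ⟨k, hk, h1, h2⟩ := hmove _ (hC N.2)
          exact ⟨k, h1, hk, h2⟩)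
        htc (fun N => (htc N).isClosed)
      rw [Set.mem_iInter] at hk
      have hkmem : k ∈ ⨅ N : C, (OrderDual.ofDual N.1 : Subgroup (T ≃g T)) :=
        Subgroup.mem_iInf.2 fun N => (hk N).2.1
      have hcl : (⨅ N : C, (OrderDual.ofDual N.1 : Subgroup (T ≃g T))) ∈ closedOvergroups G H := by
        refine ⟨?_, le_iInf fun N => (hC N.2).1.2.1,
          (iInf_le _ ⟨N₀, hN₀⟩).trans (hC hN₀).1.2.2⟩
        rw [Subgroup.coe_iInf]
        exact isClosed_iInter fun N => (hC N.2).1.1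
      refine ⟨OrderDual.toDual (⨅ N : C, (OrderDual.ofDual N.1 : Subgroup (T ≃g T))),
        ⟨hcl, fun heq => ?_⟩, fun N hN => iInf_le (fun N : C =>
          (OrderDual.ofDual N.1 : Subgroup (T ≃g T))) ⟨N, hN⟩⟩
      have hkfix := (hA _ hcl).fixes k hkmem
      have hkH : k ∈ H := heq ▸ hkmem
      have h1 := (hm.smul_bottom_eq_iff hm hkfix).1 hkH.2 (0 - l)
      rw [P.shift_eq_zero_of_fixes hkfix (hk ⟨N₀, hN₀⟩).1, add_zero] at h1
      exact (hk ⟨N₀, hN₀⟩).2.2 h1) (OrderDual.toDual K) ⟨hK, hne⟩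
  exact ⟨OrderDual.ofDual M, hMK, hM.1, fun N hN hle => hM.2 hN hle⟩

end ParentMap

end TreeFocal

/-! ### Assembly of the main theorem. -/

theorem proposition3p19 {V : Type*} (T : SimpleGraph V) (G : Subgroup (T ≃g T))
    (ξ ξ' : TreeFocal.TreeEnd T) (l : ℕ)
    (hG : TreeFocal.IsFocal G.subtype ξ)
    (hl : TreeFocal.IsMinTranslationLength G.subtype l)
    (hξ' : ξ' ≠ ξ)
    (H U₀ : Subgroup (T ≃g T)) (L : Set V)
    (hH : H = TreeFocal.endStabilizer G ξ')
    (hL : L = TreeFocal.lineBetween ξ ξ')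
    (hU₀ : U₀ = TreeFocal.fixator G L) :
    -- the decomposition of `H` that provides the translation `s`
    (∃ s ∈ H, TreeFocal.IsTranslationToward s l ξ ∧ TreeFocal.IsSemidirectCyclic H U₀ s) ∧
    -- existence of the minimal trees
    (∀ K ∈ TreeFocal.closedOvergroups G H,
      IsLeast {S : Set V | TreeFocal.IsSubtree T S ∧ TreeFocal.IsInvariant K S}
        (TreeFocal.minimalTree K)) ∧
    -- the map from `K` to its minimal tree is an order embedding
    ((∀ K ∈ TreeFocal.closedOvergroups G H, ∀ K' ∈ TreeFocal.closedOvergroups G H,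
        (TreeFocal.minimalTree K ⊆ TreeFocal.minimalTree K' ↔ K ≤ K')) ∧
      ∀ K ∈ TreeFocal.closedOvergroups G H,
        L ⊆ TreeFocal.minimalTree K ∧ (L = TreeFocal.minimalTree K ↔ K = H)) ∧
    -- the action of `K` on its minimal tree
    (∀ K ∈ TreeFocal.closedOvergroups G H, K ≠ H →
      (∃ ξK : TreeFocal.TreeEnd (T.induce (TreeFocal.minimalTree K)),
        TreeFocal.TreeEnd.map (SimpleGraph.Embedding.induce (TreeFocal.minimalTree K)) ξK = ξ ∧
        TreeFocal.IsFocal (TreeFocal.minimalTreeAction K) ξK) ∧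
      TreeFocal.IsMinTranslationLength (TreeFocal.minimalTreeAction K) l ∧
      TreeFocal.IsCompactlyGenerated K ∧
      (TreeFocal.IsScaleGroupAction G.subtype →
        TreeFocal.IsScaleGroupAction (TreeFocal.minimalTreeAction K))) ∧
    -- failure of thinness
    (∀ K ∈ TreeFocal.closedOvergroups G H, K ≠ H →
      (∀ U : Subgroup (T ≃g T), U ≤ G → U₀ ≤ U → IsCompact (U : Set (T ≃g T)) →
        IsOpen (U.subgroupOf G : Set G) → ¬ TreeFocal.IsThin U K H) ∧
      ∀ s ∈ H, TreeFocal.IsTranslationToward s l ξ →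
        ∀ v ∈ L, ∃ k ∈ K, k v = v ∧ k (s⁻¹ v) ≠ s⁻¹ v) ∧
    -- minimal elements
    ∀ K ∈ TreeFocal.closedOvergroups G H, K ≠ H →
      ∃ M ≤ K, Minimal (fun N => N ∈ TreeFocal.closedOvergroups G H ∧ N ≠ H) M := by
  obtain ⟨P⟩ := TreeFocal.exists_parentMap hG.isTree ξ
  obtain ⟨m, hm, rfl⟩ := P.exists_horoline hξ'
  rw [hm.lineBetween_eq] at hL
  subst hL hH hU₀
  have hT := hG.isTree
  have hfin := hG.locallyFinite
  have hfix : ∀ g ∈ G, g • ξ = ξ := fun g hg => hG.fixes ⟨g, hg⟩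
  have hGc : IsClosed (G : Set (T ≃g T)) := by
    have := hG.closed_range
    rwa [G.coe_subtype, Subtype.range_coe_subtype] at this
  obtain ⟨hpos, s, hs, hsl⟩ := P.exists_mem_endStabilizer_shift_eq hG hl hξ'
  have hdvd : ∀ k ∈ G, (l : ℤ) ∣ P.shift k := fun k hk => P.dvd_shift hfix hl hpos hs.1 hsl hk
  -- The element s stays arbitrary, since the last claim on vertex stabilizers concerns every
  -- translation of length l in H towards ξ.
  have hact : ∀ s ∈ TreeFocal.endStabilizer G hm.bottom, P.shift s = l →
      ∀ K ∈ TreeFocal.closedOvergroups G (TreeFocal.endStabilizer G hm.bottom),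
        P.ActsAlong m s l K := fun s hs hsl K hK =>
    { isHoroline := hm
      pos := hpos
      fixes := fun k hk => hfix k (hK.2.2 hk)
      mem := hK.2.1 hs
      apply_line := hsl ▸ (hm.smul_bottom_eq_iff hm (hfix s hs.1)).1 hs.2
      dvd_shift := fun k hk => hdvd k (hK.2.2 hk) }
  have hA := hact s hs hsl
  have hne : ∀ K ∈ TreeFocal.closedOvergroups G (TreeFocal.endStabilizer G hm.bottom),
      K ≠ TreeFocal.endStabilizer G hm.bottom → ∃ k ∈ K, k • hm.bottom ≠ hm.bottom := by
    intro K hK hKH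
    by_contra! hcon
    exact hKH (le_antisymm (fun k hk => ⟨hK.2.2 hk, hcon k hk⟩) hK.2.1)
  refine ⟨⟨s, hs, hm.isTranslationToward hpos fun i => ?_,
    TreeFocal.ParentMap.isSemidirectCyclic hm hfix hs hsl hpos hdvd⟩, fun K hK => ?_,
    ⟨fun K hK K' hK' => ⟨fun hsub => ?_, fun hle => ?_⟩, fun K hK => ⟨?_, ?_, ?_⟩⟩,
    fun K hK hKH => ?_, fun K hK hKH => ⟨fun U hUG hfU hUc hUo => ?_, ?_⟩, fun K hK hKH => ?_⟩
  · rw [(hm.smul_bottom_eq_iff hm (hfix s hs.1)).1 hs.2, hsl]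
  · rw [(hA K hK).minimalTree_eq]
    exact ⟨⟨(hA K hK).isSubtree_lineOrbit, TreeFocal.ParentMap.ActsAlong.isInvariant_lineOrbit K m⟩,
      fun S hS => (hA K hK).lineOrbit_subset hS.1 hS.2⟩
  · rw [(hA K hK).minimalTree_eq, (hA K' hK').minimalTree_eq] at hsub
    exact (hA K hK).le_of_lineOrbit_subset (hA K' hK') hT.connected hfin hK'.1 hK.2.2 hK'.2.2
      hK'.2.1 hsub
  · exact Set.sInter_subset_sInter fun S hS => ⟨hS.1, fun g hg => hS.2 g (hle hg)⟩
  · rw [(hA K hK).minimalTree_eq]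
    rintro _ ⟨i, rfl⟩
    exact TreeFocal.ParentMap.ActsAlong.mem_lineOrbit K m i
  · intro hLK
    by_contra hKH
    obtain ⟨k, hk, hk'⟩ := hne K hK hKH
    rw [(hA K hK).minimalTree_eq] at hLK
    exact hk' ((hA K hK).smul_bottom_of_lineOrbit_subset hLK.ge hk)
  · rintro rfl
    rw [(hA _ hK).minimalTree_eq]
    refine Set.Subset.antisymm ?_ ?_
    · rintro _ ⟨i, rfl⟩
      exact TreeFocal.ParentMap.ActsAlong.mem_lineOrbit _ m i
    · rintro _ ⟨k, hk, i, rfl⟩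
      exact ⟨_, ((hm.smul_bottom_eq_iff hm (hfix k hk.1)).1 hk.2 i).symm⟩
  · have h := hA K hK
    have hK' := hne K hK hKH
    unfold TreeFocal.minimalTreeAction
    -- The action depends on the invariance proof; generalizing it allows the minimal tree to be
    -- rewritten as the orbit of the line.
    generalize TreeFocal.isInvariant_minimalTree K = hS
    revert hS
    rw [h.minimalTree_eq]
    intro hS
    refine ⟨⟨h.topEnd, h.inducedEnd_topEnd, h.isFocal hT hfin hK.1 hS hK'⟩,
      h.isMinTranslationLength hS, h.isCompactlyGenerated hT.connected hfin hK.1, fun hsc => ?_⟩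
    refine h.isScaleGroupAction hT hfin hK.1 hS hK' ?_
    -- An element taking m 0 to m 1 has shift 1, so l divides 1.
    obtain ⟨⟨g, hg⟩, hgm⟩ := hsc.vertexTransitive (m 0) (m 1)
    have h1 := P.lev_apply (hfix g hg) (m 0)
    rw [show g (m 0) = m 1 from hgm, hm.lev, hm.lev, zero_add] at h1
    have h2 := hdvd g hg
    rw [← h1] at h2
    exact_mod_cast Int.eq_one_of_dvd_one (by omega) h2
  · exact (hA K hK).not_isThin hT.connected hfin hGc hK.2.2 hfix hs hK.2.1 (hne K hK hKH) hUG hfU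
      hUc hUo
  · rintro s' hs' htr _ ⟨i, rfl⟩
    have h := hact s' hs' (P.shift_eq_of_isTranslationToward (hfix s' hs'.1) htr) K hK
    rw [h.inv_apply_line]
    exact h.exists_not_fixes_below (hne K hK hKH) i
  · exact TreeFocal.ParentMap.exists_minimal_closedOvergroup hm hT.connected hfin hA hK hKH
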